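/- Let $d\ge 2$ and $k\ge 1$ be integers, and let $S^{d-1}\subset\mathbb{R}^d$ be the unit sphere. For $X\subset\mathbb{R}^d$ and $x\in X$ put $A(X)=\{\|x-y\| : x,y\in X,\ x\neq y\}$ and $A_X(x)=\{\|x-y\| : y\in X,\ y\neq x\}$. The set $X$ is called a $k$-distance set if $|A(X)|=k$, a locally $k$-distance set if $|A_X(x)|\le k$ for all $x\in X$, and antipodal if $-x\in X$ for every $x\in X$. Put $$N_d(k)=\binom{d+k-1}{k}+\binom{d+k-2}{k-1},\qquad N'_d(k)=2\binom{d+k-2}{k-1}.$$ (i) Let $X$ be a locally $k$-distance set on $S^{d-1}$. If $|X|=N_d(k)$, then $X$ is a $k$-distance set. (ii) Let $X$ be an antipodal locally $k$-distance set on $S^{d-1}$. If $|X|=N'_d(k)$, then $X$ is a $k$-distance set. -/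

import Mathlib

/-- The set `A_X(x)` of Euclidean distances from `x` to the other points of `X`. -/
def distancesFrom {d : ℕ} (X : Set (EuclideanSpace ℝ (Fin d)))
    (x : EuclideanSpace ℝ (Fin d)) : Set ℝ :=
  {r | ∃ y ∈ X, x ≠ y ∧ r = dist x y}

/-- The set `A(X)` of Euclidean distances between distinct points of `X`. -/
def distances {d : ℕ} (X : Set (EuclideanSpace ℝ (Fin d))) : Set ℝ :=
  {r | ∃ x ∈ X, ∃ y ∈ X, x ≠ y ∧ r = dist x y}

/-- `X` is a `k`-distance set: exactly `k` distances occur between distinct points of `X`. -/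
def IsKDistanceSet {d : ℕ} (k : ℕ) (X : Set (EuclideanSpace ℝ (Fin d))) : Prop :=
  (distances X).encard = k

/-- `X` is a locally `k`-distance set: from each point of `X`, at most `k` distances to the other
points of `X` occur. -/
def IsLocallyKDistanceSet {d : ℕ} (k : ℕ) (X : Set (EuclideanSpace ℝ (Fin d))) : Prop :=
  ∀ x ∈ X, (distancesFrom X x).encard ≤ k

/-- `X` is antipodal: it contains `-x` for each of its points `x`. -/
def IsAntipodal {d : ℕ} (X : Set (EuclideanSpace ℝ (Fin d))) : Prop :=
  ∀ x ∈ X, -x ∈ X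

/-- The Fisher type bound `N_d(k)`, for `d ≥ 2` and `k ≥ 1` (no subtraction truncates there). -/
def fisherBound (d k : ℕ) : ℕ :=
  (d + k - 1).choose k + (d + k - 2).choose (k - 1)

/-- The antipodal Fisher type bound `N'_d(k)`, for `d ≥ 2` and `k ≥ 1`. -/
def antipodalFisherBound (d k : ℕ) : ℕ :=
  2 * (d + k - 2).choose (k - 1)

/-! Write k = K + 1. For x ∈ X let q_x be monic of degree k, vanishing at every ⟨x, y⟩ with y ≠ x,
padded with roots at 0 if there are fewer than k such values. The functions q_x(⟨x, ·⟩) / q_x(1) are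
Lagrange functions for X in the space of polynomials of degree ≤ k on the sphere, whose dimension is
at most N_d(k). If |X| = N_d(k), they form a basis and interpolation at X is exact. The apolar
pairing of the interpolation formula with a harmonic ψ of degree k sees only leading coefficients.
It gives ⟨ψ, g⟩ = k! ∑ c_x ψ(x) g(x) for deg g ≤ k, with c_x = 1 / q_x(1) > 0
(`isApolarFunctional_of_lagrange`). The left side does not involve X, so L(F) = ∑ c_x F(x) is
determined on the products ψg, and then on all products of two polynomials of degree ≤ k
(`map_mul_eq_zero`).

For the form (f, g) ↦ L(fg), the function q_x(⟨x, ·⟩) reproduces evaluation at x. Reflect X so that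
x moves to y: the new functional L' agrees with L on products, and q_x(⟨y, ·⟩) reproduces evaluation
at y for it. So does q_y(⟨y, ·⟩) for L. The weights being positive, both kernels agree on X
(`IsApolarFunctional.eval_eq_of_reproducing`). Hence q_x vanishes at all ⟨y, z⟩ with y ≠ z, and
there are at most k distances. Fewer would give Lagrange functions of degree < k, whose functional
is zero, against L(1) > 0.

In the antipodal case X is replaced by a half Y and the inner product -1 is dropped. The q_x then
have degree K and the parity of K, the Lagrange functions lie among the forms of degree K, and L is
averaged over Y and -Y. With fewer distances, forms of degree K - 1 would already bound |Y|, by a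
smaller number. -/

open MvPolynomial Finset

namespace SphericalPolynomial

variable {d : ℕ}

/-! ### The Laplacian and harmonic polynomials -/

/-- The polynomial `x₁² + ⋯ + x_d²`. -/
noncomputable def normSqPoly (d : ℕ) : MvPolynomial (Fin d) ℝ := ∑ b, X b * X b

/-- The Laplace operator on polynomials. -/
noncomputable def laplacian (d : ℕ) : MvPolynomial (Fin d) ℝ →ₗ[ℝ] MvPolynomial (Fin d) ℝ :=
  ∑ b, (pderiv b).toLinearMap ∘ₗ (pderiv b).toLinearMap

theorem laplacian_apply (p : MvPolynomial (Fin d) ℝ) :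
    laplacian d p = ∑ b, pderiv b (pderiv b p) := by
  simp [laplacian]

/-- The harmonic homogeneous polynomials of degree `k`. -/
noncomputable def harmonic (d k : ℕ) : Submodule ℝ (MvPolynomial (Fin d) ℝ) :=
  homogeneousSubmodule (Fin d) ℝ k ⊓ LinearMap.ker (laplacian d)

theorem mem_harmonic {k : ℕ} {p : MvPolynomial (Fin d) ℝ} :
    p ∈ harmonic d k ↔ p.IsHomogeneous k ∧ laplacian d p = 0 := by
  simp [harmonic, mem_homogeneousSubmodule]

theorem pderiv_comm (a b : Fin d) (p : MvPolynomial (Fin d) ℝ) :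
    pderiv a (pderiv b p) = pderiv b (pderiv a p) := by
  ext m
  by_cases h : a = b
  · rw [h]
  · have h' : b ≠ a := Ne.symm h
    simp only [coeff_pderiv, Finsupp.add_apply, Finsupp.single_apply, h, h', if_false, add_zero]
    rw [add_right_comm]; ring

theorem laplacian_pderiv (b : Fin d) (p : MvPolynomial (Fin d) ℝ) :
    laplacian d (pderiv b p) = pderiv b (laplacian d p) := by
  simp only [laplacian_apply, map_sum]
  refine Finset.sum_congr rfl fun a _ => ?_
  rw [pderiv_comm a b, pderiv_comm a b]

theorem laplacian_X_mul (b : Fin d) (p : MvPolynomial (Fin d) ℝ) :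
    laplacian d (X b * p) = X b * laplacian d p + 2 * pderiv b p := by
  simp only [laplacian_apply, pderiv_mul, map_add, Finset.mul_sum]
  rw [show (2 : MvPolynomial (Fin d) ℝ) * pderiv b p
    = ∑ a, if a = b then 2 * pderiv b p else 0 by simp, ← Finset.sum_add_distrib]
  refine Finset.sum_congr rfl fun a _ => ?_
  by_cases h : a = b
  · subst h; simp; ring
  · simp [pderiv_X_of_ne (Ne.symm h), h]

/-- Here 2d is the Laplacian of |x|², and 4n comes from the cross term 4 ∑ x_b ∂_b p by Euler's
identity. -/
theorem laplacian_normSqPoly_mul {n : ℕ} {p : MvPolynomial (Fin d) ℝ} (hp : p.IsHomogeneous n) :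
    laplacian d (normSqPoly d * p) = normSqPoly d * laplacian d p + C (2 * d + 4 * n : ℝ) * p := by
  have e := hp.sum_X_mul_pderiv
  simp only [normSqPoly, Finset.sum_mul, map_sum, mul_assoc, laplacian_X_mul, pderiv_mul,
    pderiv_X_self, mul_add, Finset.sum_add_distrib]
  have h1 : ∑ x : Fin d, X x * (2 * pderiv x p) = 2 * (n • p) := by
    rw [← e, Finset.mul_sum]; exact Finset.sum_congr rfl fun _ _ => by ring
  have h2 : ∑ x : Fin d, 2 * (X x * pderiv x p) = 2 * (n • p) := by
    rw [← e, Finset.mul_sum]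
  rw [h1, h2]
  have h3 : (C (2 * d + 4 * n : ℝ) : MvPolynomial (Fin d) ℝ) = 2 * d + 4 * n := by
    rw [map_add, map_mul, map_mul, map_natCast, map_natCast, map_ofNat, map_ofNat]
  simp only [h3, ← mul_assoc, ← Finset.sum_mul, nsmul_eq_mul, Finset.sum_const, Finset.card_univ,
    Fintype.card_fin]
  ring

/-! ### The apolar pairing and zonal polynomials -/

/-- The apolar (Fischer) pairing with a fixed polynomial. -/
noncomputable def apolar (ψ : MvPolynomial (Fin d) ℝ) : MvPolynomial (Fin d) ℝ →ₗ[ℝ] ℝ :=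
  (MvPolynomial.basisMonomials (Fin d) ℝ).constr ℝ fun α => (∏ b, ((α b).factorial : ℝ)) * coeff α ψ

theorem apolar_monomial (ψ : MvPolynomial (Fin d) ℝ) (α : Fin d →₀ ℕ) (a : ℝ) :
    apolar ψ (monomial α a) = a * ((∏ b, ((α b).factorial : ℝ)) * coeff α ψ) := by
  have : monomial α a = a • (MvPolynomial.basisMonomials (Fin d) ℝ) α := by
    simp [smul_monomial]
  rw [this, map_smul, apolar, Module.Basis.constr_basis, smul_eq_mul]

theorem apolar_sum {ι : Type*} (s : Finset ι) (ψ : ι → MvPolynomial (Fin d) ℝ)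
    (q : MvPolynomial (Fin d) ℝ) : apolar (∑ i ∈ s, ψ i) q = ∑ i ∈ s, apolar (ψ i) q := by
  induction q using MvPolynomial.induction_on' with
  | monomial α a => simp [apolar_monomial, coeff_sum, Finset.mul_sum]
  | add p q hp hq => simp [hp, hq, Finset.sum_add_distrib]

theorem apolar_zero_left (q : MvPolynomial (Fin d) ℝ) : apolar 0 q = 0 := by
  simpa using apolar_sum (∅ : Finset (Fin d)) (fun _ => 0) q

/-- The factorial weights make multiplication by x_b adjoint to ∂_b: raising the exponent α_b by one
multiplies the weight by α_b + 1, the factor that differentiation produces. -/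
theorem apolar_X_mul (ψ : MvPolynomial (Fin d) ℝ) (b : Fin d) (q : MvPolynomial (Fin d) ℝ) :
    apolar ψ (X b * q) = apolar (pderiv b ψ) q := by
  induction q using MvPolynomial.induction_on' with
  | monomial α a =>
    have h : X b * monomial α a = monomial (α + Finsupp.single b 1) a := by
      rw [X, monomial_mul, one_mul, add_comm]
    rw [h, apolar_monomial, apolar_monomial, coeff_pderiv]
    have h2 : ∏ c, (((α + Finsupp.single b 1 : Fin d →₀ ℕ) c).factorial : ℝ)
        = (α b + 1) * ∏ c, ((α c).factorial : ℝ) := by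
      rw [← Finset.mul_prod_erase _ _ (Finset.mem_univ b),
        ← Finset.mul_prod_erase (a := b) _ (fun c => ((α c).factorial : ℝ)) (Finset.mem_univ b),
        ← mul_assoc]
      congr 1
      · simp [Nat.factorial_succ]
      · refine Finset.prod_congr rfl fun c hc => ?_
        simp [(Finset.ne_of_mem_erase hc).symm]
    rw [h2]; ring
  | add p q hp hq => simp [mul_add, hp, hq]

theorem apolar_normSqPoly_mul (ψ q : MvPolynomial (Fin d) ℝ) :
    apolar ψ (normSqPoly d * q) = apolar (laplacian d ψ) q := by
  simp [normSqPoly, Finset.sum_mul, mul_assoc, apolar_X_mul, laplacian_apply, apolar_sum]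

theorem apolar_eq_zero {m n : ℕ} {ψ q : MvPolynomial (Fin d) ℝ} (hψ : ψ.IsHomogeneous m)
    (hq : q.IsHomogeneous n) (h : n ≠ m) : apolar ψ q = 0 := by
  rw [q.as_sum, map_sum]
  refine Finset.sum_eq_zero fun α hα => ?_
  rw [apolar_monomial, hψ.coeff_eq_zero, mul_zero, mul_zero]
  intro h'
  exact h ((hq.degree_eq_sum_deg_support hα).trans h')

/-- The linear form `⟨u, ·⟩`. -/
noncomputable def linearForm (u : Fin d → ℝ) : MvPolynomial (Fin d) ℝ := ∑ b, C (u b) * X b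

theorem linearForm_isHomogeneous (u : Fin d → ℝ) : (linearForm u).IsHomogeneous 1 :=
  IsHomogeneous.sum _ _ _ fun _ _ => isHomogeneous_C_mul_X _ _

/-- Each factor ⟨u, ·⟩ moves to the other side as the derivative along u; Euler's identity at u then
collects the derivatives. -/
theorem apolar_linearForm_pow (u : Fin d → ℝ) (k : ℕ) (ψ : MvPolynomial (Fin d) ℝ)
    (hψ : ψ.IsHomogeneous k) : apolar ψ (linearForm u ^ k) = k.factorial * eval u ψ := by
  induction k generalizing ψ with
  | zero =>
    obtain ⟨a, rfl⟩ : ∃ a, ψ = C a := ⟨_, (totalDegree_eq_zero_iff_eq_C).1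
      ((totalDegree_zero_iff_isHomogeneous _).2 hψ)⟩
    rw [pow_zero, ← C_1, ← monomial_zero', apolar_monomial]
    simp
  | succ k ih =>
    have e := congrArg (eval u) hψ.sum_X_mul_pderiv
    simp only [map_sum, map_mul, eval_X, nsmul_eq_mul, map_natCast] at e
    rw [pow_succ', linearForm, Finset.sum_mul, map_sum]
    have h : ∀ b, apolar ψ (C (u b) * X b * (∑ b, C (u b) * X b) ^ k)
        = k.factorial * (u b * eval u (pderiv b ψ)) := fun b => by
      rw [mul_assoc, ← smul_eq_C_mul, map_smul, apolar_X_mul]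
      have := ih (pderiv b ψ) (by simpa using hψ.pderiv (i := b))
      rw [linearForm] at this
      rw [this, smul_eq_mul]; ring
    rw [Finset.sum_congr rfl fun b _ => h b, ← Finset.mul_sum, e, Nat.factorial_succ]
    push_cast; ring

/-- The zonal polynomial `y ↦ p(⟨u, y⟩)`. -/
noncomputable def zonal (p : Polynomial ℝ) (u : Fin d → ℝ) : MvPolynomial (Fin d) ℝ :=
  Polynomial.aeval (linearForm u) p

theorem zonal_eq_sum {p : Polynomial ℝ} {k : ℕ} (hp : p.natDegree ≤ k) (u : Fin d → ℝ) :
    zonal p u = ∑ j ∈ range (k + 1), p.coeff j • linearForm u ^ j := by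
  rw [zonal, Polynomial.aeval_eq_sum_range' (Nat.lt_succ_of_le hp)]

@[simp] theorem eval_zonal (p : Polynomial ℝ) (u y : Fin d → ℝ) :
    eval y (zonal p u) = p.eval (u ⬝ᵥ y) := by
  have : aeval y (linearForm u) = u ⬝ᵥ y := by simp [linearForm, dotProduct]
  rw [zonal, ← coe_aeval_eq_eval, RingHom.coe_coe, ← Polynomial.aeval_algHom_apply, this,
    Polynomial.coe_aeval_eq_eval]

theorem totalDegree_zonal_le {p : Polynomial ℝ} {k : ℕ} (hp : p.natDegree ≤ k) (u : Fin d → ℝ) :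
    (zonal p u).totalDegree ≤ k := by
  rw [zonal_eq_sum hp]
  refine totalDegree_finsetSum_le fun j hj => ?_
  refine (totalDegree_smul_le _ _).trans ?_
  have h := ((linearForm_isHomogeneous u).pow j).totalDegree_le
  have := Finset.mem_range.1 hj
  omega

/-- Forms of different degrees are orthogonal, so only the top power of ⟨u, ·⟩ contributes. -/
theorem apolar_zonal {k : ℕ} {ψ : MvPolynomial (Fin d) ℝ} (hψ : ψ.IsHomogeneous k)
    {p : Polynomial ℝ} (hp : p.natDegree ≤ k) (u : Fin d → ℝ) :
    apolar ψ (zonal p u) = k.factorial * (p.coeff k * eval u ψ) := by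
  rw [zonal_eq_sum hp, map_sum, Finset.sum_range_succ, Finset.sum_eq_zero, zero_add, map_smul,
    apolar_linearForm_pow u k ψ hψ, smul_eq_mul]
  · ring
  · intro j hj
    have h := (linearForm_isHomogeneous u).pow j
    rw [map_smul, apolar_eq_zero hψ h (by have := Finset.mem_range.1 hj; omega), smul_zero]


/-! ### Raising harmonic degree modulo the ideal of the sphere -/

/-- The polynomials that vanish on the unit sphere. -/
noncomputable def sphereKernel (d : ℕ) : Submodule ℝ (MvPolynomial (Fin d) ℝ) where
  carrier := {F | ∀ y : Fin d → ℝ, y ⬝ᵥ y = 1 → eval y F = 0}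
  add_mem' := fun hF hG y hy => by rw [map_add, hF y hy, hG y hy, add_zero]
  zero_mem' := fun y _ => map_zero _
  smul_mem' := fun c F hF y hy => by rw [smul_eval, hF y hy, mul_zero]

theorem eval_normSqPoly (y : Fin d → ℝ) : eval y (normSqPoly d) = y ⬝ᵥ y := by
  simp [normSqPoly, dotProduct]

theorem normSqPoly_mul_sub_mem (F : MvPolynomial (Fin d) ℝ) :
    normSqPoly d * F - F ∈ sphereKernel d := fun y hy => by
  simp [eval_normSqPoly, hy]

theorem mul_mem_sphereKernel {F : MvPolynomial (Fin d) ℝ} (hF : F ∈ sphereKernel d)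
    (G : MvPolynomial (Fin d) ℝ) : G * F ∈ sphereKernel d := fun y hy => by
  rw [map_mul, hF y hy, mul_zero]

theorem normSqPoly_isHomogeneous (d : ℕ) : (normSqPoly d).IsHomogeneous 2 :=
  IsHomogeneous.sum _ _ _ fun b _ => (isHomogeneous_X ℝ b).mul (isHomogeneous_X ℝ b)

theorem normSqPoly_ne_zero (hd : 0 < d) : normSqPoly d ≠ 0 := fun h => by
  have := eval_normSqPoly (Pi.single (⟨0, hd⟩ : Fin d) (1 : ℝ))
  simp [h] at this

theorem eval_smul_of_isHomogeneous {n : ℕ} {F : MvPolynomial (Fin d) ℝ} (hF : F.IsHomogeneous n)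
    (c : ℝ) (y : Fin d → ℝ) : eval (c • y) F = c ^ n * eval y F := by
  rw [eval_eq, eval_eq, Finset.mul_sum]
  refine Finset.sum_congr rfl fun α hα => ?_
  simp only [Pi.smul_apply, smul_eq_mul, mul_pow, Finset.prod_mul_distrib,
    Finset.prod_pow_eq_pow_sum]
  rw [show ∑ i ∈ α.support, α i = n from (hF.degree_eq_sum_deg_support hα).symm]
  ring

/-- The harmonic part of `x_b ψ`, for `ψ` harmonic of degree `i`. -/
noncomputable def harmonicRaise (i : ℕ) (b : Fin d) (ψ : MvPolynomial (Fin d) ℝ) :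
    MvPolynomial (Fin d) ℝ :=
  X b * ψ - C (2 * i + d - 2 : ℝ)⁻¹ * (normSqPoly d * pderiv b ψ)

theorem pderiv_mem_harmonic {i : ℕ} {ψ : MvPolynomial (Fin d) ℝ} (hψ : ψ ∈ harmonic d i)
    (b : Fin d) : pderiv b ψ ∈ harmonic d (i - 1) := by
  rw [mem_harmonic] at hψ ⊢
  exact ⟨hψ.1.pderiv, by rw [laplacian_pderiv, hψ.2, map_zero]⟩

theorem harmonicRaise_mem (hd : 2 ≤ d) {i : ℕ} {ψ : MvPolynomial (Fin d) ℝ}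
    (hψ : ψ ∈ harmonic d i) (b : Fin d) : harmonicRaise i b ψ ∈ harmonic d (i + 1) := by
  have hψ' := pderiv_mem_harmonic hψ b
  rw [mem_harmonic] at hψ hψ'
  rw [mem_harmonic, harmonicRaise]
  -- For i = 0 and d = 2 the constant in `harmonicRaise` is 0⁻¹ = 0; this is harmless, since it
  -- multiplies ∂_b ψ = 0.
  rcases i with _ | i
  · obtain ⟨a, rfl⟩ : ∃ a, ψ = C a := ⟨_, (totalDegree_eq_zero_iff_eq_C).1
      ((totalDegree_zero_iff_isHomogeneous _).2 hψ.1)⟩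
    rw [pderiv_C, mul_zero, mul_zero, sub_zero]
    refine ⟨?_, by rw [laplacian_X_mul, hψ.2, pderiv_C]; simp⟩
    rw [mul_comm]; exact isHomogeneous_C_mul_X _ _
  · rw [Nat.add_sub_cancel] at hψ'
    constructor
    · refine IsHomogeneous.sub ?_ (IsHomogeneous.C_mul ?_ _)
      · rw [add_comm]; exact (isHomogeneous_X ℝ b).mul hψ.1
      · rw [show i + 1 + 1 = 2 + i by ring]
        exact (normSqPoly_isHomogeneous d).mul hψ'.1
    · have hd' : (2 : ℝ) ≤ d := by exact_mod_cast hd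
      have h0 : (2 * ((i + 1 : ℕ) : ℝ) + d - 2) ≠ 0 := by
        push_cast
        linarith [(Nat.cast_nonneg i : (0 : ℝ) ≤ i)]
      rw [map_sub, ← smul_eq_C_mul, map_smul, laplacian_X_mul, laplacian_normSqPoly_mul hψ'.1,
        hψ.2, hψ'.2, smul_eq_C_mul, mul_zero, mul_zero, zero_add, zero_add, ← mul_assoc, ← C_mul,
        show (2 * ((i + 1 : ℕ) : ℝ) + d - 2)⁻¹ * (2 * d + 4 * i) = 2 by
          field_simp; push_cast; ring, map_ofNat, sub_self]

theorem sum_X_mul_harmonicRaise {i : ℕ} {ψ : MvPolynomial (Fin d) ℝ} (hψ : ψ.IsHomogeneous i) :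
    ∑ b, X b * harmonicRaise i b ψ
      = C (1 - (2 * i + d - 2 : ℝ)⁻¹ * i) * (normSqPoly d * ψ) := by
  have e := hψ.sum_X_mul_pderiv
  have h : ∀ b : Fin d, X b * harmonicRaise i b ψ = (X b * X b) * ψ
      - C (2 * i + d - 2 : ℝ)⁻¹ * normSqPoly d * (X b * pderiv b ψ) := fun b => by
    rw [harmonicRaise]; ring
  rw [Finset.sum_congr rfl fun b _ => h b, Finset.sum_sub_distrib, ← Finset.mul_sum, e,
    ← Finset.sum_mul, ← normSqPoly]
  simp [nsmul_eq_mul]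
  ring

/-- Descent from degree i + 1 to i: δ kills (`harmonicRaise i b ψ`) · (x_b g), and the sum over b is
a nonzero multiple of |x|² ψ g, which equals ψ g on the sphere. -/
theorem map_harmonic_mul_eq_zero (hd : 2 ≤ d) {δ : MvPolynomial (Fin d) ℝ →ₗ[ℝ] ℝ} {K : ℕ}
    (hδ : ∀ F ∈ sphereKernel d, δ F = 0)
    (hK : ∀ ψ ∈ harmonic d K, ∀ g : MvPolynomial (Fin d) ℝ, g.totalDegree ≤ K → δ (ψ * g) = 0)
    (n i : ℕ) (hi : i + n = K) {ψ : MvPolynomial (Fin d) ℝ} (hψ : ψ ∈ harmonic d i)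
    {g : MvPolynomial (Fin d) ℝ} (hg : g.totalDegree ≤ i) : δ (ψ * g) = 0 := by
  induction n generalizing i ψ g with
  | zero => exact hK ψ (by rwa [← hi]) g (by omega)
  | succ n ih =>
    have h1 : ∀ b, δ (harmonicRaise i b ψ * (X b * g)) = 0 := fun b =>
      ih (i + 1) (by omega) (harmonicRaise_mem hd hψ b)
        ((totalDegree_mul _ _).trans (by rw [totalDegree_X]; omega))
    have h2 := sum_X_mul_harmonicRaise (mem_harmonic.1 hψ).1
    have h3 : δ (C (1 - (2 * i + d - 2 : ℝ)⁻¹ * i) * (normSqPoly d * ψ) * g) = 0 := by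
      rw [← h2, Finset.sum_mul, map_sum]
      refine Finset.sum_eq_zero fun b _ => ?_
      rw [← h1 b]; congr 1; ring
    rw [mul_assoc, ← smul_eq_C_mul, map_smul, smul_eq_mul, mul_assoc] at h3
    have hd' : (2 : ℝ) ≤ d := by exact_mod_cast hd
    -- The factor is 1 for i = 0; for i ≥ 1 it is positive because i < 2i + d - 2.
    have h4 : (1 - (2 * i + d - 2 : ℝ)⁻¹ * i) ≠ 0 := by
      rcases i with _ | i
      · simp
      · have h0 : 0 < (2 * ((i + 1 : ℕ) : ℝ) + d - 2) := by
          push_cast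
          linarith [(Nat.cast_nonneg i : (0 : ℝ) ≤ i)]
        have h5 : (2 * ((i + 1 : ℕ) : ℝ) + d - 2)⁻¹ * ((i + 1 : ℕ) : ℝ) < 1 := by
          rw [inv_mul_lt_one₀ h0]; push_cast
          linarith [(Nat.cast_nonneg i : (0 : ℝ) ≤ i)]
        linarith
    have h5 := (mul_eq_zero.1 h3).resolve_left h4
    have h6 := hδ _ (normSqPoly_mul_sub_mem (ψ * g))
    rw [map_sub, h5] at h6
    linarith

/-! ### Harmonic decomposition on the sphere and determination of functionals -/

/-- Up to polynomials vanishing on the sphere, the sums of harmonic polynomials of degree `≤ K`. -/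
noncomputable def harmonicLE (d K : ℕ) : Submodule ℝ (MvPolynomial (Fin d) ℝ) :=
  (⨆ j : Fin (K + 1), harmonic d j) ⊔ sphereKernel d

theorem harmonic_le_harmonicLE {j K : ℕ} (h : j ≤ K) : harmonic d j ≤ harmonicLE d K :=
  le_sup_of_le_left
    (le_iSup (fun j : Fin (K + 1) => harmonic d j) ⟨j, Nat.lt_succ_of_le h⟩)

theorem sphereKernel_le_harmonicLE (K : ℕ) : sphereKernel d ≤ harmonicLE d K := le_sup_right

theorem harmonicLE_le_iff {K : ℕ} {W : Submodule ℝ (MvPolynomial (Fin d) ℝ)} :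
    harmonicLE d K ≤ W ↔ (∀ j ≤ K, harmonic d j ≤ W) ∧ sphereKernel d ≤ W := by
  rw [harmonicLE, sup_le_iff, iSup_le_iff]
  exact and_congr_left fun _ =>
    ⟨fun h j hj => h ⟨j, Nat.lt_succ_of_le hj⟩, fun h j => h j (Nat.le_of_lt_succ j.2)⟩

theorem harmonicLE_mono {K K' : ℕ} (h : K ≤ K') : harmonicLE d K ≤ harmonicLE d K' :=
  harmonicLE_le_iff.2
    ⟨fun _ hj => harmonic_le_harmonicLE (hj.trans h), sphereKernel_le_harmonicLE _⟩

/-- For ψ harmonic, x_b ψ is a harmonic polynomial of one degree more plus a multiple of |x|² ∂_b ψ,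
which on the sphere is the harmonic ∂_b ψ. -/
theorem X_mul_mem_harmonicLE (hd : 2 ≤ d) {K : ℕ} (b : Fin d) {F : MvPolynomial (Fin d) ℝ}
    (hF : F ∈ harmonicLE d K) : X b * F ∈ harmonicLE d (K + 1) := by
  suffices h : harmonicLE d K ≤ (harmonicLE d (K + 1)).comap (LinearMap.mulLeft ℝ (X b)) from h hF
  refine harmonicLE_le_iff.2 ⟨fun j hj ψ hψ => ?_, fun G hG => ?_⟩
  · have h : X b * ψ = harmonicRaise j b ψ + (2 * j + d - 2 : ℝ)⁻¹ •
        ((normSqPoly d * pderiv b ψ - pderiv b ψ) + pderiv b ψ) := by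
      rw [harmonicRaise, smul_eq_C_mul]; ring
    rw [Submodule.mem_comap, LinearMap.mulLeft_apply, h]
    refine add_mem (harmonic_le_harmonicLE (by omega) (harmonicRaise_mem hd hψ b))
      (Submodule.smul_mem _ _ (add_mem ?_ ?_))
    · exact sphereKernel_le_harmonicLE _ (normSqPoly_mul_sub_mem _)
    · exact harmonic_le_harmonicLE (by omega) (pderiv_mem_harmonic hψ b)
  · exact sphereKernel_le_harmonicLE _ (mul_mem_sphereKernel hG _)

theorem monomial_mem_harmonicLE (hd : 2 ≤ d) (n : ℕ) (α : Fin d →₀ ℕ) (hα : α.degree = n) (a : ℝ) :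
    monomial α a ∈ harmonicLE d n := by
  induction n generalizing α with
  | zero =>
    rw [(Finsupp.degree_eq_zero_iff α).1 hα, monomial_zero']
    refine harmonic_le_harmonicLE le_rfl (mem_harmonic.2 ⟨isHomogeneous_C _ _, ?_⟩)
    simp [laplacian_apply]
  | succ n ih =>
    obtain ⟨b, hb⟩ : ∃ b, α b ≠ 0 := by
      by_contra! h
      have : α = 0 := Finsupp.ext h
      simp [this] at hα
    have h1 : α = Finsupp.single b 1 + (α - Finsupp.single b 1) := by
      rw [add_tsub_cancel_of_le]
      rw [Finsupp.single_le_iff]; omega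
    have h2 : (α - Finsupp.single b 1).degree = n := by
      rw [h1, map_add, Finsupp.degree_single] at hα; omega
    have h3 : monomial α a = X b * monomial (α - Finsupp.single b 1) a := by
      rw [X, monomial_mul, one_mul, ← h1]
    rw [h3]
    exact X_mul_mem_harmonicLE hd b (ih _ h2)

theorem mem_harmonicLE (hd : 2 ≤ d) {K : ℕ} {F : MvPolynomial (Fin d) ℝ}
    (hF : F.totalDegree ≤ K) : F ∈ harmonicLE d K := by
  rw [F.as_sum]
  refine sum_mem fun α hα => ?_
  exact harmonicLE_mono ((le_totalDegree hα).trans hF) (monomial_mem_harmonicLE hd _ α rfl _)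

/-- A functional on the functions on the sphere that kills the products of a harmonic polynomial of
degree `K` and a polynomial of degree `≤ K` kills all products of two polynomials of
degree `≤ K`. -/
theorem map_mul_eq_zero (hd : 2 ≤ d) {δ : MvPolynomial (Fin d) ℝ →ₗ[ℝ] ℝ} {K : ℕ}
    (hδ : ∀ F ∈ sphereKernel d, δ F = 0)
    (hK : ∀ ψ ∈ harmonic d K, ∀ g : MvPolynomial (Fin d) ℝ, g.totalDegree ≤ K → δ (ψ * g) = 0)
    {f g : MvPolynomial (Fin d) ℝ} (hf : f.totalDegree ≤ K) (hg : g.totalDegree ≤ K) :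
    δ (f * g) = 0 := by
  -- The descent needs the second factor to have degree at most that of the harmonic one, whence j ≤
  -- i; the other pairs follow by commutativity.
  have key : ∀ i ≤ K, ∀ j ≤ i, ∀ ψ ∈ harmonic d i, ∀ φ ∈ harmonic d j, δ (ψ * φ) = 0 :=
    fun i hi j hj ψ hψ φ hφ => map_harmonic_mul_eq_zero hd hδ hK (K - i) i (by omega) hψ
      ((mem_harmonic.1 hφ).1.totalDegree_le.trans hj)
  have h1 : ∀ i ≤ K, ∀ ψ ∈ harmonic d i, δ (ψ * g) = 0 := by
    intro i hi ψ hψ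
    suffices h : harmonicLE d K ≤ LinearMap.ker (δ ∘ₗ LinearMap.mulLeft ℝ ψ) by
      simpa using h (mem_harmonicLE hd hg)
    refine harmonicLE_le_iff.2 ⟨fun j hj φ hφ => ?_, fun G hG => ?_⟩
    · rw [LinearMap.mem_ker, LinearMap.comp_apply, LinearMap.mulLeft_apply]
      rcases le_total j i with h | h
      · exact key i hi j h ψ hψ φ hφ
      · rw [mul_comm]; exact key j hj i h φ hφ ψ hψ
    · rw [LinearMap.mem_ker, LinearMap.comp_apply, LinearMap.mulLeft_apply]
      exact hδ _ (mul_mem_sphereKernel hG _)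
  suffices h : harmonicLE d K ≤ LinearMap.ker (δ ∘ₗ LinearMap.mulRight ℝ g) by
    simpa using h (mem_harmonicLE hd hf)
  refine harmonicLE_le_iff.2 ⟨fun j hj φ hφ => ?_, fun G hG => ?_⟩
  · rw [LinearMap.mem_ker, LinearMap.comp_apply, LinearMap.mulRight_apply]
    exact h1 j hj φ hφ
  · rw [LinearMap.mem_ker, LinearMap.comp_apply, LinearMap.mulRight_apply, mul_comm]
    exact hδ _ (mul_mem_sphereKernel hG _)

/-- The apolar pairing with a harmonic polynomial of degree `K` depends only on the part of parity
`K` of the restriction to the sphere. -/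
theorem apolar_eq_zero_of_parity (hd : 0 < d) {K : ℕ} {ψ F : MvPolynomial (Fin d) ℝ}
    (hψ : ψ ∈ harmonic d K) (hF : F.totalDegree ≤ K)
    (h : ∀ y : Fin d → ℝ, y ⬝ᵥ y = 1 → eval y F + (-1) ^ K * eval (-y) F = 0) :
    apolar ψ F = 0 := by
  rw [mem_harmonic] at hψ
  set f : ℕ → MvPolynomial (Fin d) ℝ := fun j => homogeneousComponent j F
  have hf : ∀ j, (f j).IsHomogeneous j := fun j => homogeneousComponent_isHomogeneous j F
  have hsum : F = ∑ j ∈ range (K + 1), f j := by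
    rw [← sum_homogeneousComponent F]
    exact (Finset.sum_subset (by simpa using by omega) fun j _ hj =>
      homogeneousComponent_eq_zero _ _ (by simpa using hj))
  -- P homogenizes the part of F of the parity of K by powers of |x|²; the halving is exact for j ≤
  -- K of that parity. By hypothesis P vanishes on the sphere, hence everywhere by scaling. As ψ is
  -- harmonic, it pairs to zero with every term of P divisible by |x|².
  set P : MvPolynomial (Fin d) ℝ := ∑ j ∈ range (K + 1),
    if Even (K + j) then normSqPoly d ^ ((K - j) / 2) * f j else 0
  have hP : P = 0 := by
    -- The extra factor |x|² disposes of y = 0, which cannot be scaled to the sphere.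
    refine (mul_eq_zero.1 (?_ : normSqPoly d * P = 0)).resolve_left (normSqPoly_ne_zero hd)
    refine MvPolynomial.funext fun y => ?_
    rw [map_mul, eval_normSqPoly, map_zero]
    by_cases hy : y = 0
    · simp [hy]
    have hpos : 0 < y ⬝ᵥ y := by
      refine lt_of_le_of_ne (Finset.sum_nonneg fun i _ => mul_self_nonneg (y i)) (Ne.symm ?_)
      exact fun h => hy (dotProduct_self_eq_zero.1 h)
    set r := Real.sqrt (y ⬝ᵥ y)
    have hr : r ^ 2 = y ⬝ᵥ y := Real.sq_sqrt hpos.le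
    have hr0 : r ≠ 0 := (Real.sqrt_pos.2 hpos).ne'
    have h1 := h (r⁻¹ • y) (by
      rw [smul_dotProduct, dotProduct_smul, ← hr, smul_eq_mul, smul_eq_mul]; field_simp)
    rw [← neg_smul, hsum, map_sum, map_sum, Finset.mul_sum, ← Finset.sum_add_distrib] at h1
    have h2 : eval y P = r ^ K / 2 * ∑ j ∈ range (K + 1),
        (eval (r⁻¹ • y) (f j) + (-1) ^ K * eval (-r⁻¹ • y) (f j)) := by
      rw [map_sum, Finset.mul_sum]
      refine Finset.sum_congr rfl fun j hj => ?_
      have hjK : j ≤ K := Nat.le_of_lt_succ (Finset.mem_range.1 hj)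
      rw [eval_smul_of_isHomogeneous (hf j), eval_smul_of_isHomogeneous (hf j), neg_pow (r⁻¹),
        show ∀ a b c e : ℝ, a * b + c * (e * a * b) = (1 + c * e) * (a * b) by intros; ring,
        ← pow_add]
      split_ifs with hE
      · obtain ⟨m, hm⟩ : ∃ m, K = j + 2 * m := by
          obtain ⟨m, hm⟩ := hE; exact ⟨m - j, by omega⟩
        rw [hE.neg_one_pow, map_mul, map_pow, eval_normSqPoly, ← hr, ← pow_mul,
          show 2 * ((K - j) / 2) = 2 * m by omega, hm, pow_add, inv_pow]
        field_simp; norm_num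
      · rw [(Nat.not_even_iff_odd.1 hE).neg_one_pow]; simp
    rw [h2, h1, mul_zero, mul_zero]
  have h3 : apolar ψ P = apolar ψ (f K) := by
    rw [map_sum, Finset.sum_range_succ, Finset.sum_eq_zero, zero_add, if_pos (Even.add_self K)]
    · simp
    · intro j hj
      have hjK := Finset.mem_range.1 hj
      split_ifs with hE
      · obtain ⟨m, hm⟩ : ∃ m, (K - j) / 2 = m + 1 := by
          obtain ⟨m, hm⟩ := hE; exact ⟨m - j - 1, by omega⟩
        rw [hm, pow_succ', mul_assoc, apolar_normSqPoly_mul, hψ.2, apolar_zero_left]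
      · exact map_zero _
  rw [hsum, map_sum, Finset.sum_range_succ, ← h3, hP, map_zero, add_zero]
  exact Finset.sum_eq_zero fun j hj =>
    apolar_eq_zero hψ.1 (hf j) (Finset.mem_range.1 hj).ne


/-! ### Dimension bounds for polynomials on the sphere -/

/-- Restriction of a polynomial to the unit sphere. -/
noncomputable def sphereRestrict (d : ℕ) :
    MvPolynomial (Fin d) ℝ →ₗ[ℝ] ({y : Fin d → ℝ // y ⬝ᵥ y = 1} → ℝ) where
  toFun F y := eval y.1 F
  map_add' _ _ := funext fun _ => map_add _ _ _
  map_smul' _ _ := funext fun _ => smul_eval _ _ _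

@[simp] theorem sphereRestrict_apply (F : MvPolynomial (Fin d) ℝ)
    (y : {y : Fin d → ℝ // y ⬝ᵥ y = 1}) : sphereRestrict d F y = eval y.1 F := rfl

/-- The restrictions to the unit sphere of the forms of degree `K`. -/
noncomputable def formSpace (d K : ℕ) : Submodule ℝ ({y : Fin d → ℝ // y ⬝ᵥ y = 1} → ℝ) :=
  Submodule.span ℝ (Set.range fun (s : Sym (Fin d) K) y => ((s : Multiset (Fin d)).map y.1).prod)

instance (K : ℕ) : FiniteDimensional ℝ (formSpace d K) :=
  FiniteDimensional.span_of_finite ℝ (Set.finite_range _)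

theorem finrank_formSpace_le (d K : ℕ) :
    Module.finrank ℝ (formSpace d K) ≤ (d + K - 1).choose K := by
  refine (finrank_range_le_card _).trans ?_
  rw [Sym.card_sym_eq_choose, Fintype.card_fin]

theorem sphereRestrict_mem_formSpace {K : ℕ} {F : MvPolynomial (Fin d) ℝ}
    (hF : F.IsHomogeneous K) : sphereRestrict d F ∈ formSpace d K := by
  rw [F.as_sum, map_sum]
  refine sum_mem fun α hα => ?_
  have h : Multiset.card (Finsupp.toMultiset α) = K := by
    rw [Finsupp.card_toMultiset, hF.degree_eq_sum_deg_support hα]; rfl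
  have h' : sphereRestrict d (monomial α (coeff α F)) = coeff α F •
      fun y : {y : Fin d → ℝ // y ⬝ᵥ y = 1} => ((Finsupp.toMultiset α).map y.1).prod := by
    funext y
    rw [sphereRestrict_apply, eval_monomial, Pi.smul_apply, smul_eq_mul, Finsupp.toMultiset_map,
      Finsupp.prod_toMultiset, Finsupp.prod_mapDomain_index (by simp) (by intros; rw [pow_add])]
  rw [h']
  exact Submodule.smul_mem _ _ (Submodule.subset_span ⟨⟨_, h⟩, rfl⟩)

theorem sphereRestrict_mem_formSpace_add {j : ℕ} {F : MvPolynomial (Fin d) ℝ}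
    (hF : F.IsHomogeneous j) (m : ℕ) : sphereRestrict d F ∈ formSpace d (2 * m + j) := by
  have h : sphereRestrict d F = sphereRestrict d (normSqPoly d ^ m * F) := by
    funext y
    simp [eval_normSqPoly, y.2]
  rw [h]
  exact sphereRestrict_mem_formSpace (((normSqPoly_isHomogeneous d).pow m).mul hF)

/-- Components of the wrong parity cancel, among them the one of degree K + 1. The others have
degree ≤ K and become forms of degree K after multiplication by a power of |x|². -/
theorem parity_part_mem_formSpace {K : ℕ} {F : MvPolynomial (Fin d) ℝ}
    (hF : F.totalDegree ≤ K + 1) :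
    (fun y : {y : Fin d → ℝ // y ⬝ᵥ y = 1} => eval y.1 F + (-1) ^ K * eval (-y.1) F)
      ∈ formSpace d K := by
  have h : (fun y : {y : Fin d → ℝ // y ⬝ᵥ y = 1} => eval y.1 F + (-1) ^ K * eval (-y.1) F)
      = ∑ j ∈ range (F.totalDegree + 1),
        (1 + (-1) ^ (K + j) : ℝ) • sphereRestrict d (homogeneousComponent j F) := by
    funext y
    conv_lhs => rw [← sum_homogeneousComponent F]
    rw [map_sum, map_sum, Finset.mul_sum, ← Finset.sum_add_distrib, Finset.sum_apply]
    refine Finset.sum_congr rfl fun j _ => ?_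
    rw [← neg_one_smul ℝ y.1,
      eval_smul_of_isHomogeneous (homogeneousComponent_isHomogeneous j F), Pi.smul_apply,
      sphereRestrict_apply, smul_eq_mul, pow_add]
    ring
  rw [h]
  refine sum_mem fun j hj => ?_
  rcases Nat.even_or_odd (K + j) with hE | hO
  · obtain ⟨m, rfl⟩ : ∃ m, K = 2 * m + j := by
      obtain ⟨m, hm⟩ := hE
      have := Finset.mem_range.1 hj
      exact ⟨m - j, by omega⟩
    exact Submodule.smul_mem _ _
      (sphereRestrict_mem_formSpace_add (homogeneousComponent_isHomogeneous j F) m)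
  · rw [hO.neg_one_pow]; simp

theorem sphereRestrict_mem_sup {K : ℕ} {F : MvPolynomial (Fin d) ℝ} (hF : F.totalDegree ≤ K + 1) :
    sphereRestrict d F ∈ formSpace d (K + 1) ⊔ formSpace d K := by
  have h : sphereRestrict d F
      = (2⁻¹ : ℝ) • (fun y => eval y.1 F + (-1) ^ (K + 1) * eval (-y.1) F)
        + (2⁻¹ : ℝ) • (fun y => eval y.1 F + (-1) ^ K * eval (-y.1) F) := by
    funext y
    simp only [sphereRestrict_apply, Pi.add_apply, Pi.smul_apply, smul_eq_mul, pow_succ]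
    ring
  rw [h]
  exact add_mem
    (Submodule.smul_mem _ _ (Submodule.mem_sup_left (parity_part_mem_formSpace (by omega))))
    (Submodule.smul_mem _ _ (Submodule.mem_sup_right (parity_part_mem_formSpace hF)))

/-! ### Lagrange interpolation in a finite-dimensional function space -/

section Lagrange

variable {S ι : Type*} [Fintype ι] [DecidableEq ι] {V : Submodule ℝ (S → ℝ)}
  {ℓ : ι → S → ℝ} {s : ι → S}

theorem linearIndependent_of_lagrange (hs : ∀ i j, ℓ i (s j) = if i = j then 1 else 0)
    (hℓ : ∀ i, ℓ i ∈ V) : LinearIndependent ℝ fun i => (⟨ℓ i, hℓ i⟩ : V) := by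
  rw [Fintype.linearIndependent_iff]
  intro c hc j
  have h := congrFun (congrArg Subtype.val hc) (s j)
  simpa [hs] using h

theorem card_le_finrank_of_lagrange [FiniteDimensional ℝ V]
    (hs : ∀ i j, ℓ i (s j) = if i = j then 1 else 0)
    (hℓ : ∀ i, ℓ i ∈ V) : Fintype.card ι ≤ Module.finrank ℝ V :=
  (linearIndependent_of_lagrange hs hℓ).fintype_card_le_finrank

theorem eq_sum_lagrange [FiniteDimensional ℝ V]
    (hs : ∀ i j, ℓ i (s j) = if i = j then 1 else 0)
    (hℓ : ∀ i, ℓ i ∈ V) (hV : Module.finrank ℝ V ≤ Fintype.card ι) {f : S → ℝ} (hf : f ∈ V)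
    (y : S) : f y = ∑ i, f (s i) * ℓ i y := by
  have hli := linearIndependent_of_lagrange hs hℓ
  have hspan := hli.span_eq_top_of_card_eq_finrank'
    (le_antisymm (card_le_finrank_of_lagrange hs hℓ) hV)
  obtain ⟨c, hc⟩ := (Submodule.mem_span_range_iff_exists_fun ℝ).1
    (hspan ▸ Submodule.mem_top : (⟨f, hf⟩ : V) ∈ Submodule.span ℝ _)
  have hc' : ∀ z, ∑ i, c i * ℓ i z = f z := fun z => by
    simpa using congrFun (congrArg Subtype.val hc) z
  have hci : ∀ j, c j = f (s j) := fun j => by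
    rw [← hc' (s j)]; simp [hs]
  rw [← hc' y]
  exact Finset.sum_congr rfl fun i _ => by rw [hci]

end Lagrange


/-! ### Functionals representing the apolar pairing -/

/-- The functionals on the functions on the sphere that represent the apolar pairing with the
harmonic polynomials of degree `K`. -/
def IsApolarFunctional (K : ℕ) (L : MvPolynomial (Fin d) ℝ →ₗ[ℝ] ℝ) : Prop :=
  (∀ F ∈ sphereKernel d, L F = 0) ∧
    ∀ ψ ∈ harmonic d K, ∀ g : MvPolynomial (Fin d) ℝ, g.totalDegree ≤ K →
      K.factorial * L (ψ * g) = apolar ψ g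

theorem IsApolarFunctional.eq_on_mul (hd : 2 ≤ d) {K : ℕ} {L L' : MvPolynomial (Fin d) ℝ →ₗ[ℝ] ℝ}
    (hL : IsApolarFunctional K L) (hL' : IsApolarFunctional K L') {f g : MvPolynomial (Fin d) ℝ}
    (hf : f.totalDegree ≤ K) (hg : g.totalDegree ≤ K) : L (f * g) = L' (f * g) := by
  refine sub_eq_zero.1 (map_mul_eq_zero (δ := L - L') hd (fun F hF => ?_)
    (fun ψ hψ g hg => ?_) hf hg)
  · rw [LinearMap.sub_apply, hL.1 F hF, hL'.1 F hF, sub_zero]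
  · have hK : (K.factorial : ℝ) ≠ 0 := by exact_mod_cast K.factorial_ne_zero
    rw [LinearMap.sub_apply, sub_eq_zero]
    exact mul_left_cancel₀ hK ((hL.2 ψ hψ g hg).trans (hL'.2 ψ hψ g hg).symm)

/-- Since L and L' agree on products, f and f' represent the same evaluation for one form, and L((f'
- f)²) expands to f'(u) - f'(u) - f(u) + f(u) = 0. Positive weights force f' - f to vanish at each
node. -/
theorem IsApolarFunctional.eval_eq_of_reproducing (hd : 2 ≤ d) {K : ℕ}
    {L L' : MvPolynomial (Fin d) ℝ →ₗ[ℝ] ℝ}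
    (hL : IsApolarFunctional K L) (hL' : IsApolarFunctional K L') {f f' : MvPolynomial (Fin d) ℝ}
    (hf : f.totalDegree ≤ K) (hf' : f'.totalDegree ≤ K) {u : Fin d → ℝ}
    (h1 : L (f * f) = eval u f) (h2 : L (f' * f) = eval u f')
    (h3 : L' (f' * f') = eval u f') (h4 : L' (f * f') = eval u f)
    {ι : Type*} [Fintype ι] {c : ι → ℝ} (hc : ∀ i, 0 < c i) {v : ι → Fin d → ℝ}
    (h5 : L ((f' - f) * (f' - f)) = ∑ i, c i * eval (v i) (f' - f) ^ 2) (i : ι) :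
    eval (v i) f' = eval (v i) f := by
  have e1 := hL.eq_on_mul hd hL' hf' hf'
  have e2 := hL.eq_on_mul hd hL' hf hf'
  have e3 : (f' - f) * (f' - f) = f' * f' - f' * f - f * f' + f * f := by ring
  have e4 : f' * f = f * f' := mul_comm _ _
  rw [e3, map_add, map_sub, map_sub, h1, h2, e1, e2, h3, h4] at h5
  rw [e4, e2, h4] at h2
  have h6 : ∑ i, c i * eval (v i) (f' - f) ^ 2 = 0 := by rw [← h5]; linarith
  have h7 := (Finset.sum_eq_zero_iff_of_nonneg fun j _ =>
    mul_nonneg (hc j).le (sq_nonneg _)).1 h6 i (Finset.mem_univ i)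
  have h8 := pow_eq_zero_iff (two_ne_zero) |>.1 ((mul_eq_zero.1 h7).resolve_left (hc i).ne')
  rw [map_sub] at h8
  linarith

section Configuration

variable {ι : Type*} [Fintype ι]

/-- The functional `F ↦ ∑ cᵢ F(vᵢ)`. -/
noncomputable def pointFunctional (v : ι → Fin d → ℝ) (c : ι → ℝ) :
    MvPolynomial (Fin d) ℝ →ₗ[ℝ] ℝ where
  toFun F := ∑ i, c i * eval (v i) F
  map_add' F G := by simp [mul_add, Finset.sum_add_distrib]
  map_smul' a F := by
    simp only [smul_eval, RingHom.id_apply, smul_eq_mul, Finset.mul_sum]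
    exact Finset.sum_congr rfl fun i _ => by ring

theorem pointFunctional_apply (v : ι → Fin d → ℝ) (c : ι → ℝ) (F : MvPolynomial (Fin d) ℝ) :
    pointFunctional v c F = ∑ i, c i * eval (v i) F := rfl

theorem pointFunctional_eq_zero {v : ι → Fin d → ℝ} (hv : ∀ i, v i ⬝ᵥ v i = 1) (c : ι → ℝ)
    {F : MvPolynomial (Fin d) ℝ} (hF : F ∈ sphereKernel d) : pointFunctional v c F = 0 :=
  Finset.sum_eq_zero fun i _ => by rw [hF _ (hv i), mul_zero]

variable [DecidableEq ι]

theorem isApolarFunctional_of_lagrange (hd : 2 ≤ d) {K : ℕ} {v : ι → Fin d → ℝ}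
    (hv : ∀ i, v i ⬝ᵥ v i = 1) {p : ι → Polynomial ℝ} (hp : ∀ i, (p i).natDegree ≤ K + 1)
    (hpv : ∀ i j, (p i).eval (v i ⬝ᵥ v j) = if i = j then 1 else 0)
    (hι : (d + K).choose (K + 1) + (d + K - 1).choose K ≤ Fintype.card ι) :
    IsApolarFunctional (K + 1) (pointFunctional v fun i => (p i).coeff (K + 1)) := by
  refine ⟨fun F hF => pointFunctional_eq_zero hv _ hF, fun ψ hψ g hg => ?_⟩
  have hrep : ∀ y : Fin d → ℝ, y ⬝ᵥ y = 1 →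
      eval y g = ∑ i, eval (v i) g * (p i).eval (v i ⬝ᵥ y) := by
    intro y hy
    have h := eq_sum_lagrange (V := formSpace d (K + 1) ⊔ formSpace d K)
      (ℓ := fun i => sphereRestrict d (zonal (p i) (v i))) (s := fun i => ⟨v i, hv i⟩)
      (fun i j => by simp [hpv]) (fun i => sphereRestrict_mem_sup (totalDegree_zonal_le (hp i) _))
      ((Submodule.finrank_add_le_finrank_add_finrank _ _).trans ((add_le_add
        (finrank_formSpace_le _ _) (finrank_formSpace_le _ _)).trans hι))
      (sphereRestrict_mem_sup hg) ⟨y, hy⟩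
    simpa using h
  -- G is the interpolant minus g. It vanishes on the sphere, so ψ pairs equally with both, and the
  -- pairing with the interpolant is the weighted point sum.
  set G := (∑ i, eval (v i) g • zonal (p i) (v i)) - g with hG
  have hGdeg : G.totalDegree ≤ K + 1 :=
    (totalDegree_sub _ _).trans (max_le (totalDegree_finsetSum_le fun i _ =>
      (totalDegree_smul_le _ _).trans (totalDegree_zonal_le (hp i) _)) hg)
  have hGS : ∀ y : Fin d → ℝ, y ⬝ᵥ y = 1 → eval y G = 0 := fun y hy => by
    rw [hG, map_sub, map_sum, hrep y hy]; simp [smul_eval]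
  have h := apolar_eq_zero_of_parity (by omega) hψ hGdeg fun y hy => by
    rw [hGS y hy, hGS (-y) (by simpa using hy)]; simp
  rw [hG, map_sub, sub_eq_zero, map_sum] at h
  rw [← h, pointFunctional_apply, Finset.mul_sum]
  refine Finset.sum_congr rfl fun i _ => ?_
  rw [map_smul, apolar_zonal (mem_harmonic.1 hψ).1 (hp i), map_mul, smul_eq_mul]
  ring

theorem zonal_mem_formSpace {K : ℕ} {p : Polynomial ℝ} (hp : p.natDegree ≤ K)
    (hpar : ∀ t, p.eval (-t) = (-1) ^ K * p.eval t) (u : Fin d → ℝ) :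
    sphereRestrict d (zonal p u) ∈ formSpace d K := by
  have h : sphereRestrict d (zonal p u) = (2⁻¹ : ℝ) • fun y : {y : Fin d → ℝ // y ⬝ᵥ y = 1} =>
      eval y.1 (zonal p u) + (-1) ^ K * eval (-y.1) (zonal p u) := by
    funext y
    simp only [sphereRestrict_apply, eval_zonal, dotProduct_neg, hpar, Pi.smul_apply, smul_eq_mul,
      ← mul_assoc, ← mul_pow]
    norm_num
    ring
  rw [h]
  exact Submodule.smul_mem _ _
    (parity_part_mem_formSpace ((totalDegree_zonal_le hp u).trans K.le_succ))

theorem card_le_of_lagrange_of_parity {K : ℕ} {v : ι → Fin d → ℝ}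
    (hv : ∀ i, v i ⬝ᵥ v i = 1) {p : ι → Polynomial ℝ} (hp : ∀ i, (p i).natDegree ≤ K)
    (hpar : ∀ i t, (p i).eval (-t) = (-1) ^ K * (p i).eval t)
    (hpv : ∀ i j, (p i).eval (v i ⬝ᵥ v j) = if i = j then 1 else 0) :
    Fintype.card ι ≤ (d + K - 1).choose K :=
  (card_le_finrank_of_lagrange (V := formSpace d K)
    (ℓ := fun i => sphereRestrict d (zonal (p i) (v i))) (s := fun i => ⟨v i, hv i⟩)
    (fun i j => by simp [hpv]) (fun i => zonal_mem_formSpace (hp i) (hpar i) _)).trans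
    (finrank_formSpace_le _ _)

/-- The nodes determine only the part of g of the parity of K, which is all that a harmonic
polynomial of degree K sees. Averaging over v and -v extracts that part from the point sum. -/
theorem isApolarFunctional_of_lagrange_of_parity (hd : 2 ≤ d) {K : ℕ} {v : ι → Fin d → ℝ}
    (hv : ∀ i, v i ⬝ᵥ v i = 1) {p : ι → Polynomial ℝ} (hp : ∀ i, (p i).natDegree ≤ K)
    (hpar : ∀ i t, (p i).eval (-t) = (-1) ^ K * (p i).eval t)
    (hpv : ∀ i j, (p i).eval (v i ⬝ᵥ v j) = if i = j then 1 else 0)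
    (hι : (d + K - 1).choose K ≤ Fintype.card ι) :
    IsApolarFunctional K ((2⁻¹ : ℝ) • (pointFunctional v (fun i => (p i).coeff K)
      + pointFunctional (-v) fun i => (p i).coeff K)) := by
  refine ⟨fun F hF => ?_, fun ψ hψ g hg => ?_⟩
  · rw [LinearMap.smul_apply, LinearMap.add_apply, pointFunctional_eq_zero hv _ hF,
      pointFunctional_eq_zero (fun i => by simpa using hv i) _ hF]
    simp
  have hrep : ∀ y : Fin d → ℝ, y ⬝ᵥ y = 1 → eval y g + (-1) ^ K * eval (-y) g
      = ∑ i, (eval (v i) g + (-1) ^ K * eval (-v i) g) * (p i).eval (v i ⬝ᵥ y) := by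
    intro y hy
    have h := eq_sum_lagrange (V := formSpace d K)
      (ℓ := fun i => sphereRestrict d (zonal (p i) (v i))) (s := fun i => ⟨v i, hv i⟩)
      (fun i j => by simp [hpv]) (fun i => zonal_mem_formSpace (hp i) (hpar i) _)
      ((finrank_formSpace_le _ _).trans hι)
      (parity_part_mem_formSpace (hg.trans K.le_succ)) ⟨y, hy⟩
    simpa using h
  have hsq : ((-1 : ℝ) ^ K) * (-1) ^ K = 1 := by rw [← mul_pow]; norm_num
  set G := (∑ i, (2⁻¹ * (eval (v i) g + (-1) ^ K * eval (-v i) g)) • zonal (p i) (v i)) - g with hG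
  have hGdeg : G.totalDegree ≤ K :=
    (totalDegree_sub _ _).trans (max_le (totalDegree_finsetSum_le fun i _ =>
      (totalDegree_smul_le _ _).trans (totalDegree_zonal_le (hp i) _)) hg)
  have h := apolar_eq_zero_of_parity (by omega) hψ hGdeg fun y hy => by
    have e : ∀ z : Fin d → ℝ, eval z (∑ i, (2⁻¹ * (eval (v i) g + (-1) ^ K * eval (-v i) g)) •
        zonal (p i) (v i)) = 2⁻¹ * ∑ i, (eval (v i) g + (-1) ^ K * eval (-v i) g) *
          (p i).eval (v i ⬝ᵥ z) := fun z => by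
      rw [map_sum, Finset.mul_sum]
      exact Finset.sum_congr rfl fun i _ => by rw [smul_eval, eval_zonal, mul_assoc]
    rw [hG, map_sub, map_sub, e, e, ← hrep y hy, ← hrep (-y) (by simpa using hy), neg_neg]
    linear_combination 2⁻¹ * (eval y g) * hsq
  rw [hG, map_sub, sub_eq_zero, map_sum] at h
  rw [← h, LinearMap.smul_apply, LinearMap.add_apply, pointFunctional_apply, pointFunctional_apply,
    ← Finset.sum_add_distrib, smul_eq_mul, Finset.mul_sum, Finset.mul_sum]
  refine Finset.sum_congr rfl fun i _ => ?_
  have hψi : eval (-v i) ψ = (-1) ^ K * eval (v i) ψ := by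
    rw [← neg_one_smul ℝ, eval_smul_of_isHomogeneous (mem_harmonic.1 hψ).1]
  rw [map_smul, apolar_zonal (mem_harmonic.1 hψ).1 (hp i), map_mul, map_mul, smul_eq_mul,
    Pi.neg_apply, hψi]
  ring

end Configuration

/-! ### Extremal configurations -/

/-- A reflection carries any vector of a family of unit vectors to any other one. -/
theorem exists_isometric_family {ι : Type*} {v : ι → Fin d → ℝ} (hv : ∀ i, v i ⬝ᵥ v i = 1)
    (i j : ι) : ∃ v' : ι → Fin d → ℝ, (∀ l m, v' l ⬝ᵥ v' m = v l ⬝ᵥ v m) ∧ v' i = v j := by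
  by_cases h : v i = v j
  · exact ⟨v, fun _ _ => rfl, h⟩
  set w := v i - v j with hw
  have hw0 : w ⬝ᵥ w ≠ 0 := fun h0 => h (sub_eq_zero.1 (dotProduct_self_eq_zero.1 h0))
  refine ⟨fun l => v l - (2 * (v l ⬝ᵥ w) / (w ⬝ᵥ w)) • w, fun l m => ?_, ?_⟩
  · simp only [sub_dotProduct, dotProduct_sub, smul_dotProduct, dotProduct_smul, smul_eq_mul,
      dotProduct_comm w (v m)]
    field_simp
    ring
  · have h1 : w ⬝ᵥ w = 2 * (v i ⬝ᵥ w) := by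
      rw [hw]
      simp only [sub_dotProduct, dotProduct_sub, hv, dotProduct_comm (v j) (v i)]
      ring
    simp only
    rw [← h1, div_self hw0, one_smul, hw, sub_sub_cancel]


variable {ι : Type*} [DecidableEq ι]

theorem lagrange_of_annihilator {v : ι → Fin d → ℝ} (hv : ∀ i, v i ⬝ᵥ v i = 1)
    {q : ι → Polynomial ℝ} (h1 : ∀ i, 0 < (q i).eval 1)
    (hqv : ∀ i j, i ≠ j → (q i).eval (v i ⬝ᵥ v j) = 0) (i j : ι) :
    (Polynomial.C ((q i).eval 1)⁻¹ * q i).eval (v i ⬝ᵥ v j) = if i = j then 1 else 0 := by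
  rw [Polynomial.eval_mul, Polynomial.eval_C]
  split_ifs with h
  · rw [← h, hv, inv_mul_cancel₀ (h1 i).ne']
  · rw [hqv i j h, mul_zero]

theorem natDegree_C_mul_le_of_le {K : ℕ} {q : Polynomial ℝ} (hq : q.natDegree ≤ K) (a : ℝ) :
    (Polynomial.C a * q).natDegree ≤ K := (Polynomial.natDegree_C_mul_le _ _).trans hq

variable [Fintype ι]

/-- In an extremal configuration, the annihilator of any point annihilates all inner products. -/
theorem eval_annihilator_eq_zero (hd : 2 ≤ d) {K : ℕ} {v : ι → Fin d → ℝ}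
    (hv : ∀ i, v i ⬝ᵥ v i = 1) {q : ι → Polynomial ℝ} (hq : ∀ i, (q i).natDegree ≤ K + 1)
    (hqK : ∀ i, (q i).coeff (K + 1) = 1) (h1 : ∀ i, 0 < (q i).eval 1)
    (hqv : ∀ i j, i ≠ j → (q i).eval (v i ⬝ᵥ v j) = 0)
    (hι : (d + K).choose (K + 1) + (d + K - 1).choose K ≤ Fintype.card ι)
    (i : ι) {j l : ι} (hjl : j ≠ l) : (q i).eval (v j ⬝ᵥ v l) = 0 := by
  obtain ⟨v', hv', hij⟩ := exists_isometric_family hv i j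
  have hc : (fun i => (Polynomial.C ((q i).eval 1)⁻¹ * q i).coeff (K + 1))
      = fun i => ((q i).eval 1)⁻¹ := by
    funext i; rw [Polynomial.coeff_C_mul, hqK, mul_one]
  have hL := isApolarFunctional_of_lagrange hd hv (fun i => natDegree_C_mul_le_of_le (hq i) _)
    (lagrange_of_annihilator hv h1 hqv) hι
  have hL' := isApolarFunctional_of_lagrange hd (v := v') (fun i => by rw [hv', hv])
    (fun i => natDegree_C_mul_le_of_le (hq i) _)
    (fun i j => by rw [hv']; exact lagrange_of_annihilator hv h1 hqv i j) hι
  rw [hc] at hL hL'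
  have hrep : ∀ (w : ι → Fin d → ℝ) (_ : ∀ l m, w l ⬝ᵥ w m = v l ⬝ᵥ v m) (m : ι)
      (g : MvPolynomial (Fin d) ℝ),
      pointFunctional w (fun i => ((q i).eval 1)⁻¹) (g * zonal (q m) (w m)) = eval (w m) g := by
    intro w hw m g
    rw [pointFunctional_apply, Finset.sum_eq_single m]
    · rw [map_mul, eval_zonal, hw, hv]
      have := (h1 m).ne'
      field_simp
    · intro b _ hb
      rw [map_mul, eval_zonal, hw, hqv m b hb.symm, mul_zero, mul_zero]
    · simp
  -- Two kernels for evaluation at v j = v' i: the one built from q j for L, and the one built from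
  -- q i for L'.
  have h := hL.eval_eq_of_reproducing hd hL' (u := v j)
    (totalDegree_zonal_le (hq j) (v j)) (totalDegree_zonal_le (hq i) (v j))
    (hrep v (fun _ _ => rfl) j _) (hrep v (fun _ _ => rfl) j _)
    (by have := hrep v' hv' i (zonal (q i) (v j)); rwa [hij] at this)
    (by have := hrep v' hv' i (zonal (q j) (v j)); rwa [hij] at this)
    (fun i => inv_pos.2 (h1 i)) (v := v)
    (by simp only [pointFunctional_apply, map_mul, sq]) l
  rw [eval_zonal, eval_zonal, hqv j l hjl] at h
  exact h

/-- In an extremal configuration, the Lagrange polynomials do not all have lower degree. -/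
theorem exists_lagrange_natDegree_gt (hd : 2 ≤ d) {K : ℕ} [Nonempty ι] {v : ι → Fin d → ℝ}
    (hv : ∀ i, v i ⬝ᵥ v i = 1) {q : ι → Polynomial ℝ} (hq : ∀ i, (q i).natDegree ≤ K + 1)
    (hqK : ∀ i, (q i).coeff (K + 1) = 1) (h1 : ∀ i, 0 < (q i).eval 1)
    (hqv : ∀ i j, i ≠ j → (q i).eval (v i ⬝ᵥ v j) = 0)
    (hι : (d + K).choose (K + 1) + (d + K - 1).choose K ≤ Fintype.card ι)
    {p : ι → Polynomial ℝ}
    (hpv : ∀ i j, (p i).eval (v i ⬝ᵥ v j) = if i = j then 1 else 0) :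
    ∃ i, K < (p i).natDegree := by
  by_contra! hp
  have hL := isApolarFunctional_of_lagrange hd hv (fun i => natDegree_C_mul_le_of_le (hq i) _)
    (lagrange_of_annihilator hv h1 hqv) hι
  -- If every p i had degree ≤ K, the weights of this functional, the coefficients in degree K + 1,
  -- would all be 0; but it must agree with the positive one at 1 · 1.
  have hL' := isApolarFunctional_of_lagrange hd hv (fun i => (hp i).trans K.le_succ) hpv hι
  have h := hL.eq_on_mul hd hL' (f := 1) (g := 1) (by simp) (by simp)
  simp only [pointFunctional_apply, mul_one, map_one, Polynomial.coeff_C_mul, hqK] at h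
  rw [Finset.sum_eq_zero (f := fun i => (p i).coeff (K + 1)) fun i _ =>
    Polynomial.coeff_eq_zero_of_natDegree_lt (Nat.lt_succ_of_le (hp i))] at h
  exact (Finset.sum_pos (fun i _ => inv_pos.2 (h1 i)) Finset.univ_nonempty).ne' h

/-- In an extremal half of an antipodal configuration, the annihilator of any point annihilates all
inner products. -/
theorem eval_annihilator_eq_zero_of_parity (hd : 2 ≤ d) {K : ℕ} {v : ι → Fin d → ℝ}
    (hv : ∀ i, v i ⬝ᵥ v i = 1) {q : ι → Polynomial ℝ} (hq : ∀ i, (q i).natDegree ≤ K)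
    (hqK : ∀ i, (q i).coeff K = 1) (h1 : ∀ i, 0 < (q i).eval 1)
    (hpar : ∀ i t, (q i).eval (-t) = (-1) ^ K * (q i).eval t)
    (hqv : ∀ i j, i ≠ j → (q i).eval (v i ⬝ᵥ v j) = 0)
    (hι : (d + K - 1).choose K ≤ Fintype.card ι)
    (i : ι) {j l : ι} (hjl : j ≠ l) : (q i).eval (v j ⬝ᵥ v l) = 0 := by
  obtain ⟨v', hv', hij⟩ := exists_isometric_family hv i j
  have hc : (fun i => (Polynomial.C ((q i).eval 1)⁻¹ * q i).coeff K)
      = fun i => ((q i).eval 1)⁻¹ := by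
    funext i; rw [Polynomial.coeff_C_mul, hqK, mul_one]
  have hpar' : ∀ i t, (Polynomial.C ((q i).eval 1)⁻¹ * q i).eval (-t)
      = (-1) ^ K * (Polynomial.C ((q i).eval 1)⁻¹ * q i).eval t := fun i t => by
    rw [Polynomial.eval_mul, Polynomial.eval_mul, hpar, Polynomial.eval_C, Polynomial.eval_C]; ring
  have hL := isApolarFunctional_of_lagrange_of_parity hd hv
    (fun i => natDegree_C_mul_le_of_le (hq i) _) hpar' (lagrange_of_annihilator hv h1 hqv) hι
  have hL' := isApolarFunctional_of_lagrange_of_parity hd (v := v') (fun i => by rw [hv', hv])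
    (fun i => natDegree_C_mul_le_of_le (hq i) _) hpar'
    (fun i j => by rw [hv']; exact lagrange_of_annihilator hv h1 hqv i j) hι
  rw [hc] at hL hL'
  have hsq : ((-1 : ℝ) ^ K) * (-1) ^ K = 1 := by rw [← mul_pow]; norm_num
  -- On a product of two functions of parity K, the nodes v and -v contribute equally, so the
  -- averaged functional is a sum over one half with positive weights.
  have hsym : ∀ (w : ι → Fin d → ℝ) (f g : MvPolynomial (Fin d) ℝ)
      (_ : ∀ y, eval (-y) f = (-1) ^ K * eval y f) (_ : ∀ y, eval (-y) g = (-1) ^ K * eval y g),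
      ((2⁻¹ : ℝ) • (pointFunctional w (fun i => ((q i).eval 1)⁻¹)
        + pointFunctional (-w) fun i => ((q i).eval 1)⁻¹)) (f * g)
      = ∑ i, ((q i).eval 1)⁻¹ * (eval (w i) f * eval (w i) g) := by
    intro w f g hf hg
    rw [LinearMap.smul_apply, LinearMap.add_apply, pointFunctional_apply, pointFunctional_apply,
      ← Finset.sum_add_distrib, smul_eq_mul, Finset.mul_sum]
    refine Finset.sum_congr rfl fun i _ => ?_
    rw [map_mul, map_mul, Pi.neg_apply, hf, hg]
    linear_combination (2⁻¹ * ((q i).eval 1)⁻¹ * eval (w i) f * eval (w i) g) * hsq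
  have hz : ∀ (i : ι) (u y : Fin d → ℝ),
      eval (-y) (zonal (q i) u) = (-1) ^ K * eval y (zonal (q i) u) :=
    fun i u y => by rw [eval_zonal, eval_zonal, dotProduct_neg, hpar]
  have hrep : ∀ (w : ι → Fin d → ℝ) (_ : ∀ l m, w l ⬝ᵥ w m = v l ⬝ᵥ v m) (m n : ι)
      (u : Fin d → ℝ),
      ((2⁻¹ : ℝ) • (pointFunctional w (fun i => ((q i).eval 1)⁻¹)
        + pointFunctional (-w) fun i => ((q i).eval 1)⁻¹)) (zonal (q n) u * zonal (q m) (w m))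
      = eval (w m) (zonal (q n) u) := by
    intro w hw m n u
    rw [hsym w _ _ (hz n u) (hz m _), Finset.sum_eq_single m]
    · rw [eval_zonal _ (w m), hw, hv]
      have := (h1 m).ne'
      field_simp
    · intro b _ hb
      rw [eval_zonal _ (w m), hw, hqv m b hb.symm, mul_zero, mul_zero]
    · simp
  have h := hL.eval_eq_of_reproducing hd hL' (u := v j)
    (totalDegree_zonal_le (hq j) (v j)) (totalDegree_zonal_le (hq i) (v j))
    (hrep v (fun _ _ => rfl) j _ _) (hrep v (fun _ _ => rfl) j _ _)
    (by have := hrep v' hv' i i (v j); rwa [hij] at this)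
    (by have := hrep v' hv' i j (v j); rwa [hij] at this)
    (fun i => inv_pos.2 (h1 i)) (v := v)
    (by
      rw [hsym v] <;> intros
      · simp only [sq]
      all_goals rw [map_sub, map_sub, hz, hz]; ring) l
  rw [eval_zonal, eval_zonal, hqv j l hjl] at h
  exact h

end SphericalPolynomial

namespace SphericalPolynomial

/-! ### Annihilator polynomials -/

/-- The monic polynomial of degree `K` with roots at `D` and, with multiplicity, at `0`. -/
noncomputable def annihilator (D : Finset ℝ) (K : ℕ) : Polynomial ℝ :=
  Polynomial.X ^ (K - D.card) * ∏ t ∈ D, (Polynomial.X - Polynomial.C t)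

section annihilator

variable {D : Finset ℝ} {K : ℕ}

theorem annihilator_monic (D : Finset ℝ) (K : ℕ) : (annihilator D K).Monic :=
  (Polynomial.monic_X_pow _).mul (Polynomial.monic_prod_X_sub_C _ _)

theorem natDegree_annihilator (h : D.card ≤ K) : (annihilator D K).natDegree = K := by
  rw [annihilator, (Polynomial.monic_X_pow _).natDegree_mul (Polynomial.monic_prod_X_sub_C _ _),
    Polynomial.natDegree_X_pow, Polynomial.natDegree_finsetProd_X_sub_C_eq_card]
  omega

theorem coeff_annihilator (h : D.card ≤ K) : (annihilator D K).coeff K = 1 := by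
  have := (annihilator_monic D K).coeff_natDegree
  rwa [natDegree_annihilator h] at this

theorem eval_annihilator (D : Finset ℝ) (K : ℕ) (s : ℝ) :
    (annihilator D K).eval s = s ^ (K - D.card) * ∏ t ∈ D, (s - t) := by
  simp [annihilator, Polynomial.eval_prod]

theorem eval_annihilator_eq_zero_of_mem {t : ℝ} (ht : t ∈ D) : (annihilator D K).eval t = 0 := by
  rw [eval_annihilator, Finset.prod_eq_zero ht (sub_self t), mul_zero]

theorem eval_one_annihilator_pos (h : ∀ t ∈ D, t < 1) : 0 < (annihilator D K).eval 1 := by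
  rw [eval_annihilator, one_pow, one_mul]
  exact Finset.prod_pos fun t ht => sub_pos.2 (h t ht)

/-- The substitution t ↦ -t in the product over D gives the sign (-1)^|D|, and the padding power
supplies the rest. -/
theorem eval_neg_annihilator (hK : D.card ≤ K) (hD : ∀ t ∈ D, -t ∈ D) (s : ℝ) :
    (annihilator D K).eval (-s) = (-1) ^ K * (annihilator D K).eval s := by
  have h : ∏ t ∈ D, (-s - t) = (-1) ^ D.card * ∏ t ∈ D, (s - t) := by
    rw [← Finset.prod_const, ← Finset.prod_mul_distrib]
    exact Finset.prod_nbij' (fun t => -t) (fun t => -t) hD hD (fun _ _ => neg_neg _)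
      (fun _ _ => neg_neg _) fun _ _ => by ring
  obtain ⟨m, rfl⟩ := Nat.exists_eq_add_of_le hK
  rw [eval_annihilator, eval_annihilator, h, neg_pow, Nat.add_sub_cancel_left, pow_add]
  ring

theorem encard_le_of_forall_eval_annihilator {S : Set ℝ} (hK : D.card ≤ K)
    (hS : ∀ t ∈ S, (annihilator D K).eval t = 0) : S.encard ≤ K := by
  have h : S ⊆ ((annihilator D K).roots.toFinset : Set ℝ) := fun t ht => by
    rw [Finset.mem_coe, Multiset.mem_toFinset, Polynomial.mem_roots (annihilator_monic D K).ne_zero]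
    exact hS t ht
  refine (Set.encard_le_encard h).trans ?_
  rw [Set.encard_coe_eq_coe_finsetCard]
  exact_mod_cast (Multiset.toFinset_card_le _).trans
    ((Polynomial.card_roots' _).trans (natDegree_annihilator hK).le)

end annihilator

theorem exists_finset_of_encard_le {S : Set ℝ} {n : ℕ} (h : S.encard ≤ n) :
    ∃ D : Finset ℝ, (D : Set ℝ) = S ∧ D.card ≤ n := by
  have hf := Set.finite_of_encard_le_coe h
  refine ⟨hf.toFinset, hf.coe_toFinset, ?_⟩
  rw [← hf.coe_toFinset, Set.encard_coe_eq_coe_finsetCard] at h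
  exact_mod_cast h

/-! ### Distances, inner products and the first assertion -/

section distances

variable {d : ℕ}

/-- The inner product of two unit vectors at distance `r`. -/
noncomputable def distToInner (r : ℝ) : ℝ := 1 - r ^ 2 / 2

theorem inner_eq_dotProduct (x y : EuclideanSpace ℝ (Fin d)) : inner ℝ x y = x.ofLp ⬝ᵥ y.ofLp := by
  rw [EuclideanSpace.inner_eq_star_dotProduct, dotProduct_comm]; rfl

variable {X : Set (EuclideanSpace ℝ (Fin d))} {x y : EuclideanSpace ℝ (Fin d)}

theorem norm_eq_one (hX : X ⊆ Metric.sphere 0 1) (hx : x ∈ X) : ‖x‖ = 1 := by simpa using hX hx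

theorem dotProduct_self_eq_one (hX : X ⊆ Metric.sphere 0 1) (hx : x ∈ X) : x.ofLp ⬝ᵥ x.ofLp = 1 := by
  rw [← inner_eq_dotProduct, real_inner_self_eq_norm_sq, norm_eq_one hX hx, one_pow]

theorem distToInner_dist (hX : X ⊆ Metric.sphere 0 1) (hx : x ∈ X) (hy : y ∈ X) :
    distToInner (dist x y) = x.ofLp ⬝ᵥ y.ofLp := by
  rw [distToInner, dist_eq_norm, norm_sub_sq_real, norm_eq_one hX hx, norm_eq_one hX hy,
    inner_eq_dotProduct]
  ring

theorem dotProduct_lt_one (hX : X ⊆ Metric.sphere 0 1) (hx : x ∈ X) (hy : y ∈ X)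
    (hxy : x ≠ y) : x.ofLp ⬝ᵥ y.ofLp < 1 := by
  rw [← distToInner_dist hX hx hy, distToInner]
  have := pow_pos (dist_pos.2 hxy) 2
  linarith

theorem neg_eq_of_dotProduct_eq (hX : X ⊆ Metric.sphere 0 1) (hx : x ∈ X) (hy : y ∈ X)
    (hxy : x.ofLp ⬝ᵥ y.ofLp = -1) :
    y = -x := by
  rw [eq_neg_iff_add_eq_zero, ← norm_eq_zero, ← sq_eq_zero_iff, norm_add_sq_real,
    norm_eq_one hX hx, norm_eq_one hX hy, real_inner_comm, inner_eq_dotProduct, hxy]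
  norm_num

theorem mem_image_distancesFrom (hX : X ⊆ Metric.sphere 0 1) (hx : x ∈ X) (t : ℝ) :
    t ∈ distToInner '' distancesFrom X x ↔
    ∃ y ∈ X, x ≠ y ∧ t = x.ofLp ⬝ᵥ y.ofLp := by
  constructor
  · rintro ⟨_, ⟨y, hy, hxy, rfl⟩, rfl⟩
    exact ⟨y, hy, hxy, distToInner_dist hX hx hy⟩
  · rintro ⟨y, hy, hxy, rfl⟩
    exact ⟨_, ⟨y, hy, hxy, rfl⟩, distToInner_dist hX hx hy⟩

theorem mem_image_distances (hX : X ⊆ Metric.sphere 0 1) (t : ℝ) : t ∈ distToInner '' distances X ↔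
    ∃ x ∈ X, ∃ y ∈ X, x ≠ y ∧ t = x.ofLp ⬝ᵥ y.ofLp := by
  constructor
  · rintro ⟨_, ⟨x, hx, y, hy, hxy, rfl⟩, rfl⟩
    exact ⟨x, hx, y, hy, hxy, distToInner_dist hX hx hy⟩
  · rintro ⟨x, hx, y, hy, hxy, rfl⟩
    exact ⟨_, ⟨x, hx, y, hy, hxy, rfl⟩, distToInner_dist hX hx hy⟩

theorem encard_image_distances (X : Set (EuclideanSpace ℝ (Fin d))) :
    (distToInner '' distances X).encard = (distances X).encard := by
  refine Set.InjOn.encard_image ?_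
  rintro _ ⟨x, _, y, _, _, rfl⟩ _ ⟨z, _, w, _, _, rfl⟩ h
  rw [distToInner, distToInner] at h
  exact (sq_eq_sq₀ dist_nonneg dist_nonneg).1 (by linarith)

theorem isKDistanceSet_of_encard_eq_fisherBound (hX : X ⊆ Metric.sphere 0 1) (hd : 2 ≤ d) {K : ℕ}
    (hloc : IsLocallyKDistanceSet (K + 1) X) (hcard : X.encard = fisherBound d (K + 1)) :
    IsKDistanceSet (K + 1) X := by
  classical
  have hfin : X.Finite := Set.finite_of_encard_eq_coe hcard
  let _ : Fintype X := hfin.fintype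
  have hι : (d + K).choose (K + 1) + (d + K - 1).choose K = Fintype.card X := by
    rw [Set.encard_eq_coe_toFinset_card, Set.toFinset_card] at hcard
    exact_mod_cast hcard.symm
  have hpos : 0 < Fintype.card X := by
    have : 0 < (d + K).choose (K + 1) := Nat.choose_pos (by omega)
    omega
  have : Nonempty X := Fintype.card_pos_iff.1 hpos
  have hex : ∀ x : X, ∃ D : Finset ℝ, (D : Set ℝ) = distToInner '' distancesFrom X x ∧
      D.card ≤ K + 1 := fun x =>
    exists_finset_of_encard_le ((Set.encard_image_le _ _).trans (hloc x x.2))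
  choose D hD hDcard using hex
  have hmem : ∀ (x : X) (t : ℝ), t ∈ D x ↔
      ∃ y ∈ X, (x : EuclideanSpace ℝ (Fin d)) ≠ y ∧ t = x.1.ofLp ⬝ᵥ y.ofLp := fun x t => by
    rw [← mem_image_distancesFrom hX x.2, ← hD, Finset.mem_coe]
  have hv : ∀ x : X, x.1.ofLp ⬝ᵥ x.1.ofLp = 1 := fun x => dotProduct_self_eq_one hX x.2
  have h1 : ∀ x : X, 0 < (annihilator (D x) (K + 1)).eval 1 := fun x =>
    eval_one_annihilator_pos fun t ht => by
      obtain ⟨y, hy, hxy, rfl⟩ := (hmem x t).1 ht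
      exact dotProduct_lt_one hX x.2 hy hxy
  have hqv : ∀ x y : X, x ≠ y → (annihilator (D x) (K + 1)).eval (x.1.ofLp ⬝ᵥ y.1.ofLp) = 0 :=
    fun x y hxy => eval_annihilator_eq_zero_of_mem
      ((hmem x _).2 ⟨y, y.2, fun h => hxy (Subtype.ext h), rfl⟩)
  have hdeg := fun x => (natDegree_annihilator (hDcard x)).le
  have hcoeff := fun x => coeff_annihilator (hDcard x)
  have hle : (distToInner '' distances X).encard ≤ (K + 1 : ℕ) := by
    obtain ⟨x₀⟩ := ‹Nonempty X›
    refine encard_le_of_forall_eval_annihilator (hDcard x₀) fun t ht => ?_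
    obtain ⟨y, hy, z, hz, hyz, rfl⟩ := (mem_image_distances hX t).1 ht
    exact eval_annihilator_eq_zero hd (v := fun x : X => x.1.ofLp) hv hdeg hcoeff h1 hqv hι.le x₀
      (j := ⟨y, hy⟩) (l := ⟨z, hz⟩) fun h => hyz (congrArg Subtype.val h)
  obtain ⟨D₀, hD₀, hD₀card⟩ := exists_finset_of_encard_le hle
  rw [IsKDistanceSet, ← encard_image_distances, ← hD₀, Set.encard_coe_eq_coe_finsetCard]
  rcases hD₀card.lt_or_eq with hlt | heq
  -- With at most K inner products in all, a single polynomial of degree K would serve as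
  -- annihilator for every point.
  · exfalso
    have hlt' : D₀.card ≤ K := Nat.le_of_lt_succ hlt
    have hmem₀ : ∀ t, t ∈ D₀ ↔ ∃ x ∈ X, ∃ y ∈ X, x ≠ y ∧ t = x.ofLp ⬝ᵥ y.ofLp := fun t => by
      rw [← mem_image_distances hX, ← hD₀, Finset.mem_coe]
    have hp := lagrange_of_annihilator (v := fun x : X => x.1.ofLp) hv
      (q := fun _ => annihilator D₀ K)
      (fun _ => eval_one_annihilator_pos fun t ht => by
        obtain ⟨x, hx, y, hy, hxy, rfl⟩ := (hmem₀ t).1 ht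
        exact dotProduct_lt_one hX hx hy hxy)
      (fun x y hxy => eval_annihilator_eq_zero_of_mem
        ((hmem₀ _).2 ⟨x, x.2, y, y.2, fun h => hxy (Subtype.ext h), rfl⟩))
    obtain ⟨i, hi⟩ := exists_lagrange_natDegree_gt hd (v := fun x : X => x.1.ofLp)
      hv hdeg hcoeff h1 hqv hι.le hp
    exact hi.not_ge (natDegree_C_mul_le_of_le (natDegree_annihilator hlt').le _)
  · rw [heq]

/-! ### The antipodal case -/

/-- An antipodal set without `0` is the disjoint union of some `Y` and `-Y`. -/
theorem exists_half_of_isAntipodal (hX : X ⊆ Metric.sphere 0 1) (hanti : IsAntipodal X) :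
    ∃ Y ⊆ X, (∀ x ∈ X, x ∈ Y ∨ -x ∈ Y) ∧ ∀ x ∈ Y, -x ∉ Y := by
  -- Y consists of the lexicographically positive points.
  refine ⟨{x | x ∈ X ∧ 0 < toLex x.ofLp}, fun x hx => hx.1, fun x hx => ?_, fun x hx hx' => ?_⟩
  · have h0 : toLex x.ofLp ≠ 0 := fun h => by
      have hx0 : x = 0 := (WithLp.ofLp_eq_zero 2).1 h
      have := norm_eq_one hX hx
      simp [hx0] at this
    rcases lt_or_gt_of_ne h0 with h | h
    · exact Or.inr ⟨hanti x hx, neg_pos.2 h⟩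
    · exact Or.inl ⟨hx, h⟩
  · exact lt_asymm hx.2 (neg_pos.1 hx'.2)

theorem encard_eq_two_mul_of_half {Y : Set (EuclideanSpace ℝ (Fin d))} (hanti : IsAntipodal X)
    (hYX : Y ⊆ X) (hcover : ∀ x ∈ X, x ∈ Y ∨ -x ∈ Y) (hdisj : ∀ x ∈ Y, -x ∉ Y) :
    X.encard = 2 * Y.encard := by
  have h : X = Y ∪ (fun x => -x) '' Y := by
    ext x
    constructor
    · intro hx
      rcases hcover x hx with h | h
      · exact Or.inl h
      · exact Or.inr ⟨-x, h, neg_neg x⟩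
    · rintro (h | ⟨y, hy, rfl⟩)
      · exact hYX h
      · exact hanti y (hYX hy)
  have hd : Disjoint Y ((fun x => -x) '' Y) := by
    rw [Set.disjoint_left]
    rintro x hx ⟨y, hy, rfl⟩
    exact hdisj y hy hx
  rw [h, Set.encard_union_eq hd, neg_injective.injOn.encard_image, two_mul]

theorem neg_dotProduct_mem (hX : X ⊆ Metric.sphere 0 1) (hanti : IsAntipodal X) (hx : x ∈ X)
    (hy : y ∈ X) (hxy : x ≠ y) (ht : x.ofLp ⬝ᵥ y.ofLp ≠ -1) :
    ∃ z ∈ X, x ≠ z ∧ -(x.ofLp ⬝ᵥ y.ofLp) = x.ofLp ⬝ᵥ z.ofLp ∧ -(x.ofLp ⬝ᵥ y.ofLp) ≠ -1 := by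
  refine ⟨-y, hanti y hy, fun h => ht ?_, by rw [WithLp.ofLp_neg, dotProduct_neg], fun h => ?_⟩
  · rw [h, WithLp.ofLp_neg, neg_dotProduct, dotProduct_self_eq_one hX hy]
  · exact (dotProduct_lt_one hX hx hy hxy).ne (neg_injective h)

theorem isKDistanceSet_of_encard_eq_antipodalFisherBound (hX : X ⊆ Metric.sphere 0 1) (hd : 2 ≤ d)
    {K : ℕ} (hanti : IsAntipodal X) (hloc : IsLocallyKDistanceSet (K + 1) X)
    (hcard : X.encard = antipodalFisherBound d (K + 1)) : IsKDistanceSet (K + 1) X := by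
  classical
  obtain ⟨Y, hYX, hcover, hdisj⟩ := exists_half_of_isAntipodal hX hanti
  have hfin : Y.Finite := (Set.finite_of_encard_eq_coe hcard).subset hYX
  let _ : Fintype Y := hfin.fintype
  have hι : (d + K - 1).choose K = Fintype.card Y := by
    rw [encard_eq_two_mul_of_half hanti hYX hcover hdisj, Set.encard_eq_coe_toFinset_card,
      Set.toFinset_card] at hcard
    have h : 2 * Fintype.card Y = 2 * (d + K - 1).choose K := by exact_mod_cast hcard
    omega
  have hpos : 0 < Fintype.card Y := by rw [← hι]; exact Nat.choose_pos (by omega)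
  obtain ⟨x₀⟩ : Nonempty Y := Fintype.card_pos_iff.1 hpos
  have hself : ∀ x ∈ X, x ≠ -x ∧ -1 = x.ofLp ⬝ᵥ (-x).ofLp := fun x hx => by
    have h : -1 = x.ofLp ⬝ᵥ (-x).ofLp := by
      rw [WithLp.ofLp_neg, dotProduct_neg, dotProduct_self_eq_one hX hx]
    refine ⟨fun h' => ?_, h⟩
    rw [← h', dotProduct_self_eq_one hX hx] at h
    norm_num at h
  -- The inner product -1 always occurs, with the antipode. Dropping it leaves at most K values, a
  -- set stable under negation.
  have hex : ∀ x : Y, ∃ D : Finset ℝ, (D : Set ℝ) = distToInner '' distancesFrom X x \ {-1} ∧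
      D.card ≤ K := fun x => by
    refine exists_finset_of_encard_le ?_
    have h1 : (-1 : ℝ) ∈ distToInner '' distancesFrom X x :=
      (mem_image_distancesFrom hX (hYX x.2) _).2
        ⟨-x, hanti x (hYX x.2), hself x (hYX x.2)⟩
    have h2 := (Set.encard_image_le distToInner _).trans (hloc x (hYX x.2))
    rw [← Set.encard_sdiff_singleton_add_one h1, Nat.cast_add, Nat.cast_one] at h2
    exact (ENat.add_le_add_iff_right ENat.one_ne_top).1 h2
  choose D hD hDcard using hex
  have hmem : ∀ (x : Y) (t : ℝ), t ∈ D x ↔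
      ∃ y ∈ X, (x : EuclideanSpace ℝ (Fin d)) ≠ y ∧ t = x.1.ofLp ⬝ᵥ y.ofLp ∧ t ≠ -1 :=
    fun x t => by
      rw [← Finset.mem_coe, hD, Set.mem_sdiff, mem_image_distancesFrom hX (hYX x.2)]
      simp only [Set.mem_singleton_iff]
      constructor
      · rintro ⟨⟨y, hy, hxy, h⟩, h'⟩; exact ⟨y, hy, hxy, h, h'⟩
      · rintro ⟨y, hy, hxy, h, h'⟩; exact ⟨⟨y, hy, hxy, h⟩, h'⟩
  have hY1 : ∀ x y : Y, x.1.ofLp ⬝ᵥ y.1.ofLp ≠ -1 := fun x y h =>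
    hdisj x x.2 (neg_eq_of_dotProduct_eq hX (hYX x.2) (hYX y.2) h ▸ y.2)
  have hv : ∀ x : Y, x.1.ofLp ⬝ᵥ x.1.ofLp = 1 := fun x => dotProduct_self_eq_one hX (hYX x.2)
  have h1 : ∀ x : Y, 0 < (annihilator (D x) K).eval 1 := fun x =>
    eval_one_annihilator_pos fun t ht => by
      obtain ⟨y, hy, hxy, rfl, _⟩ := (hmem x t).1 ht
      exact dotProduct_lt_one hX (hYX x.2) hy hxy
  have hqv : ∀ x y : Y, x ≠ y → (annihilator (D x) K).eval (x.1.ofLp ⬝ᵥ y.1.ofLp) = 0 :=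
    fun x y hxy => eval_annihilator_eq_zero_of_mem
      ((hmem x _).2 ⟨y, hYX y.2, fun h => hxy (Subtype.ext h), rfl, hY1 x y⟩)
  have hpar : ∀ (x : Y) (t : ℝ),
      (annihilator (D x) K).eval (-t) = (-1) ^ K * (annihilator (D x) K).eval t := fun x =>
    eval_neg_annihilator (hDcard x) fun t ht => by
      obtain ⟨y, hy, hxy, rfl, ht'⟩ := (hmem x t).1 ht
      exact (hmem x _).2 (neg_dotProduct_mem hX hanti (hYX x.2) hy hxy ht')
  have hroot : ∀ x ∈ Y, ∀ y ∈ Y, x ≠ y →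
      (annihilator (D x₀) K).eval (x.ofLp ⬝ᵥ y.ofLp) = 0 := fun x hx y hy hxy =>
    eval_annihilator_eq_zero_of_parity hd (v := fun x : Y => x.1.ofLp) hv
      (fun x => (natDegree_annihilator (hDcard x)).le) (fun x => coeff_annihilator (hDcard x)) h1
      hpar hqv hι.le x₀ (j := ⟨x, hx⟩) (l := ⟨y, hy⟩) fun h => hxy (congrArg Subtype.val h)
  -- Passing from Y to X changes inner products only by a sign, which the parity of the annihilator
  -- absorbs.
  have hrootX : ∀ x ∈ X, ∀ y ∈ X, x ≠ y → y ≠ -x →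
      (annihilator (D x₀) K).eval (x.ofLp ⬝ᵥ y.ofLp) = 0 := by
    intro x hx y hy hxy hxy'
    rcases hcover x hx with h | h <;> rcases hcover y hy with h' | h'
    · exact hroot x h y h' hxy
    · have := hroot x h (-y) h' fun e => hxy' (by rw [e, neg_neg])
      rw [WithLp.ofLp_neg, dotProduct_neg] at this
      rw [← neg_neg (x.ofLp ⬝ᵥ y.ofLp), hpar, this, mul_zero]
    · have := hroot (-x) h y h' fun e => hxy' e.symm
      rw [WithLp.ofLp_neg, neg_dotProduct] at this
      rw [← neg_neg (x.ofLp ⬝ᵥ y.ofLp), hpar, this, mul_zero]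
    · have := hroot (-x) h (-y) h' fun e => hxy (neg_injective e)
      rwa [WithLp.ofLp_neg, WithLp.ofLp_neg, neg_dotProduct_neg] at this
  have hle : (distToInner '' distances X \ {-1}).encard ≤ K := by
    refine encard_le_of_forall_eval_annihilator (hDcard x₀) fun t ht => ?_
    obtain ⟨y, hy, z, hz, hyz, rfl⟩ := (mem_image_distances hX t).1 ht.1
    refine hrootX y hy z hz hyz ?_
    rintro rfl
    exact ht.2 (hself y hy).2.symm
  have hneg : (-1 : ℝ) ∈ distToInner '' distances X := (mem_image_distances hX _).2
    ⟨x₀, hYX x₀.2, -x₀, hanti x₀ (hYX x₀.2), hself x₀ (hYX x₀.2)⟩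
  obtain ⟨D₀, hD₀, hD₀card⟩ := exists_finset_of_encard_le hle
  rw [IsKDistanceSet, ← encard_image_distances, ← Set.encard_sdiff_singleton_add_one hneg, ← hD₀,
    Set.encard_coe_eq_coe_finsetCard]
  rcases hD₀card.lt_or_eq with hlt | heq
  · exfalso
    -- With at most m = K - 1 values, the annihilator of degree m puts the Lagrange functions among
    -- the forms of degree m, so |Y| is at most the binomial coefficient for m. By Pascal's rule the
    -- one for K is larger by a positive term.
    obtain ⟨m, rfl⟩ : ∃ m, K = m + 1 := ⟨K - 1, by omega⟩
    have hlt' : D₀.card ≤ m := Nat.le_of_lt_succ hlt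
    have hmem₀ : ∀ t, t ∈ D₀ ↔
        (∃ x ∈ X, ∃ y ∈ X, x ≠ y ∧ t = x.ofLp ⬝ᵥ y.ofLp) ∧ t ≠ -1 := fun t => by
      rw [← mem_image_distances hX, ← Finset.mem_coe, hD₀]; rfl
    have hpar₀ := eval_neg_annihilator hlt' fun t ht => by
      obtain ⟨⟨x, hx, y, hy, hxy, rfl⟩, ht'⟩ := (hmem₀ t).1 ht
      obtain ⟨z, hz, hxz, h, h'⟩ := neg_dotProduct_mem hX hanti hx hy hxy ht'
      exact (hmem₀ _).2 ⟨⟨x, hx, z, hz, hxz, h⟩, h'⟩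
    have hp := lagrange_of_annihilator (v := fun x : Y => x.1.ofLp) hv
      (q := fun _ => annihilator D₀ m)
      (fun _ => eval_one_annihilator_pos fun t ht => by
        obtain ⟨⟨x, hx, y, hy, hxy, rfl⟩, _⟩ := (hmem₀ t).1 ht
        exact dotProduct_lt_one hX hx hy hxy)
      (fun x y hxy => eval_annihilator_eq_zero_of_mem
        ((hmem₀ _).2 ⟨⟨x, hYX x.2, y, hYX y.2, fun h => hxy (Subtype.ext h), rfl⟩, hY1 x y⟩))
    have hle' := card_le_of_lagrange_of_parity hv
      (fun _ => natDegree_C_mul_le_of_le (natDegree_annihilator hlt').le _)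
      (fun _ t => by
        rw [Polynomial.eval_mul, Polynomial.eval_mul, hpar₀, Polynomial.eval_C, Polynomial.eval_C]
        ring) hp
    obtain ⟨e, rfl⟩ : ∃ e, d = e + 2 := ⟨d - 2, by omega⟩
    rw [← hι, show e + 2 + (m + 1) - 1 = (e + 1 + m) + 1 by omega,
      show e + 2 + m - 1 = e + 1 + m by omega, Nat.choose_succ_succ'] at hle'
    have : 0 < (e + 1 + m).choose (m + 1) := Nat.choose_pos (by omega)
    omega
  · rw [heq]; rfl

end distances

end SphericalPolynomial

theorem theorem3 (d k : ℕ) (hd : 2 ≤ d) (hk : 1 ≤ k) :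
    (∀ X : Set (EuclideanSpace ℝ (Fin d)), X ⊆ Metric.sphere 0 1 →
      IsLocallyKDistanceSet k X → X.encard = fisherBound d k → IsKDistanceSet k X) ∧
    (∀ X : Set (EuclideanSpace ℝ (Fin d)), X ⊆ Metric.sphere 0 1 → IsAntipodal X →
      IsLocallyKDistanceSet k X → X.encard = antipodalFisherBound d k → IsKDistanceSet k X) := by
  obtain ⟨K, rfl⟩ : ∃ K, k = K + 1 := ⟨k - 1, by omega⟩
  exact ⟨fun X hX hloc hcard =>
      SphericalPolynomial.isKDistanceSet_of_encard_eq_fisherBound hX hd hloc hcard,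
    fun X hX hanti hloc hcard =>
      SphericalPolynomial.isKDistanceSet_of_encard_eq_antipodalFisherBound hX hd hanti hloc hcard⟩
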